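/- Let $m>0$, $\omega_{\mathbf p}=\sqrt{|\mathbf p|^2+m^2}$ for $\mathbf p\in\mathbb R^3$, and $d\mu(\mathbf p)=d^3\mathbf p/(2\omega_{\mathbf p})$. For $x=(x^0,\mathbf x)\in\mathbb R\times\mathbb R^3$ write $p\cdot x=\omega_{\mathbf p}x^0-\mathbf p\cdot\mathbf x$. Let $\mathscr F=\bigoplus_{k\ge 0}\mathscr H_k^+$ be the bosonic Fock space, where $\mathscr H_k^+$ is the space of symmetric functions in $L^2((\mathbb R^3)^k,d\mu^{\otimes k})$. For measurable $c:\mathbb R^3\to\mathbb C$ let $\int d\mu(\mathbf p)\,c(\mathbf p)\,a_c(\mathbf p)$ be the operator $$\Psi\mapsto\Phi,\qquad \Phi_k(\mathbf p_1,\dots,\mathbf p_k)=\sqrt{k+1}\int d\mu(\mathbf p)\,c(\mathbf p)\,\Psi_{k+1}(\mathbf p,\mathbf p_1,\dots,\mathbf p_k),$$ on the maximal domain of all $\Psi\in\mathscr F$ for which, for every $k$, these integrals converge absolutely almost everywhere and $\Phi\in\mathscr F$. Put $a(\mathbf p)=a_c(\mathbf p)/\sqrt{2\omega_{\mathbf p}}$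 and $$\phi_1(x)=\int d\mu(\mathbf p)\,\overline{\Psi_x(\mathbf p)}\,a_c(\mathbf p),\quad \Psi_x(\mathbf p)=(2\pi)^{-3/2}e^{ip\cdot x}(2\omega_{\mathbf p})^{1/2},\qquad \tilde a(\mathbf x)=(2\pi)^{-3/2}\int d^3\mathbf p\,e^{i\mathbf p\cdot\mathbf x}a(\mathbf p).$$ For $y=(y^0,\mathbf y)\in\mathbb R^4$ and $R\in SO(3)$, with $\Lambda_R=\mathrm{diag}(1,R)$, let $U(y,\Lambda_R)$ be the unitary operator on $\mathscr F$ given by $$(U(y,\Lambda_R)\Psi)_k(\mathbf p_1,\dots,\mathbf p_k)=e^{i(p_1+\cdots+p_k)\cdot y}\,\Psi_k(R^{-1}\mathbf p_1,\dots,R^{-1}\mathbf p_k).$$ Let $\mathscr D$ be the set of vectors in $\mathscr F$ with finitely many nonzero components, all of which are (a.e. equal to) Schwartz functions. For complex $t$ and $\mathbf v\in\mathbb R^3$ put $$\mathcal K_t(\mathbf v)=\frac{it}{2\pi^2}\,\frac{m^2K_2\!\left(m\sqrt{|\mathbf v|^2-t^2}\right)}{|\mathbf v|^2-t^2},$$ with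 the principal square root and the modified Bessel function $K_2(w)=\int_0^\infty e^{-w\cosh s}\cosh(2s)\,ds$, $\operatorname{Re}w>0$. **Theorem.** For all $y\in\mathbb R^4$ and $R\in SO(3)$: 1. For every $x=(x_0,\mathbf x)\in\mathbb R^4$, $\mathscr D$ is contained in the domain of $\phi_1(x)$, and $$U(y,\Lambda_R)\,\phi_1(x)\,U(y,\Lambda_R)^{-1}=\phi_1(x_0+y_0,\,R\mathbf x+\mathbf y)$$ as an equality of unbounded operators, including their domains. 2. For every $\mathbf x\in\mathbb R^3$, $$U(y,\Lambda_R)\,\tilde a(\mathbf x)\,U(y,\Lambda_R)^{-1}=\left(\mathcal K_{y^0-i0}\ast\tilde a\right)(R\mathbf x+\mathbf y)$$ on $\mathscr D$. That is, every $\Psi\in\mathscr D$ lies in the domain of the left-hand side and of every $\tilde a(\mathbf z)$, $\mathbf z\in\mathbb R^3$; for every $\varepsilon>0$ the function $\mathbf z\mapsto\mathcal K_{y^0-i\varepsilon}(R\mathbf x+\mathbf y-\mathbf z)\,\tilde a(\mathbf z)\Psi$ is Bochner integrable; and, in the norm of $\mathscr F$, $$U(y,\Lambda_R)\,\tilde a(\mathbf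 x)\,U(y,\Lambda_R)^{-1}\Psi=\lim_{\varepsilon\to0^+}\int d^3\mathbf z\;\mathcal K_{y^0-i\varepsilon}(R\mathbf x+\mathbf y-\mathbf z)\,\tilde a(\mathbf z)\Psi .$$ In the space-like region $|\mathbf v|>|y^0|$, $\mathcal K_{y^0-i\varepsilon}(\mathbf v)$ converges, locally uniformly in $\mathbf v$ as $\varepsilon\to0^+$, to $$\mathcal K_{y^0}(\mathbf v)=\frac{iy^0}{2\pi^2}\,\frac{m^2K_2\!\left(m\sqrt{|\mathbf v|^2-(y^0)^2}\right)}{|\mathbf v|^2-(y^0)^2}.$$ -/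

import Mathlib

open MeasureTheory Filter Topology Real

noncomputable section

namespace ScalarField

/-- Momentum space, and also coordinate space, for space dimension three. -/
abbrev E3 : Type := EuclideanSpace ℝ (Fin 3)

/-- Points `x = (x⁰, 𝐱)` of four-dimensional Minkowski space-time. -/
abbrev SpaceTime : Type := ℝ × E3

/-- The relativistic energy `ω_𝐩 = √(𝐩² + m²)`. -/
def omega (m : ℝ) (p : E3) : ℝ := √(‖p‖ ^ 2 + m ^ 2)

/-- The Lorentz-invariant measure `d³𝐩 / (2 ω_𝐩)` on the mass shell, parametrized by `𝐩`. -/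
def shellMeasure (m : ℝ) : Measure E3 :=
  (volume : Measure E3).withDensity (fun p => ENNReal.ofReal (1 / (2 * omega m p)))

/-- The Minkowski product `p · x = ω_𝐩 x⁰ - 𝐩 · 𝐱` of the on-shell four-momentum
`p = (ω_𝐩, 𝐩)` with a space-time point. -/
def shellDot (m : ℝ) (p : E3) (x : SpaceTime) : ℝ := omega m p * x.1 - inner ℝ p x.2

/-- The product measure on `k`-tuples of momenta. -/
abbrev shellMeasurePi (m : ℝ) (k : ℕ) : Measure (Fin k → E3) :=
  Measure.pi (fun _ : Fin k => shellMeasure m)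

instance (m : ℝ) : SigmaFinite (shellMeasure m) := by
  unfold shellMeasure; infer_instance

theorem continuous_omega (m : ℝ) : Continuous (omega m) := by
  unfold omega; fun_prop

theorem continuous_shellDot (m : ℝ) (x : SpaceTime) : Continuous (fun p => shellDot m p x) := by
  unfold shellDot
  have := continuous_omega m
  fun_prop

theorem measurePreserving_perm (m : ℝ) {k : ℕ} (σ : Equiv.Perm (Fin k)) :
    MeasurePreserving (fun p : Fin k → E3 => p ∘ σ) (shellMeasurePi m k) (shellMeasurePi m k) := by
  have h := measurePreserving_piCongrLeft (fun _ : Fin k => shellMeasure m) σ.symm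
  convert h using 1
  ext p i
  simp [MeasurableEquiv.coe_piCongrLeft, Equiv.piCongrLeft, Equiv.piCongrLeft']

/-- The symmetric `k`-particle space `ℋ_k⁺`: square-integrable functions of `k` momenta that are
invariant under all permutations of their arguments. For `k = 0` this is `ℂ`. -/
def symmSpace (m : ℝ) (k : ℕ) : Submodule ℂ (Lp ℂ 2 (shellMeasurePi m k)) where
  carrier := {f | ∀ σ : Equiv.Perm (Fin k),
    (fun p : Fin k → E3 => f (p ∘ σ)) =ᵐ[shellMeasurePi m k] f}
  zero_mem' := by
    intro σ
    have h0 := Lp.coeFn_zero ℂ 2 (shellMeasurePi m k)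
    have h1 := (measurePreserving_perm m σ).quasiMeasurePreserving.ae h0
    filter_upwards [h0, h1] with p hp hp'
    rw [hp, hp']; rfl
  add_mem' := by
    intro f g hf hg σ
    have h0 := Lp.coeFn_add f g
    have h1 := (measurePreserving_perm m σ).quasiMeasurePreserving.ae h0
    filter_upwards [h0, h1, hf σ, hg σ] with p hp hp' hfp hgp
    rw [hp, hp', Pi.add_apply, Pi.add_apply, hfp, hgp]
  smul_mem' := by
    intro c f hf σ
    have h0 := Lp.coeFn_smul c f
    have h1 := (measurePreserving_perm m σ).quasiMeasurePreserving.ae h0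
    filter_upwards [h0, h1, hf σ] with p hp hp' hfp
    rw [hp, hp', Pi.smul_apply, Pi.smul_apply, hfp]

theorem isClosed_symmSpace (m : ℝ) (k : ℕ) :
    IsClosed (symmSpace m k : Set (Lp ℂ 2 (shellMeasurePi m k))) := by
  have h : (symmSpace m k : Set (Lp ℂ 2 (shellMeasurePi m k))) =
      ⋂ σ : Equiv.Perm (Fin k),
        {f | Lp.compMeasurePreserving _ (measurePreserving_perm m σ) f = f} := by
    ext f
    simp only [Set.mem_iInter, Set.mem_ofPred_eq]
    refine forall_congr' fun σ => ?_
    have h1 := Lp.coeFn_compMeasurePreserving f (measurePreserving_perm m σ)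
    constructor
    · intro h
      exact Lp.ext (h1.trans h)
    · intro h
      rw [h] at h1
      exact h1.symm
  rw [h]
  refine isClosed_iInter fun σ => isClosed_eq ?_ continuous_id
  exact (Lp.isometry_compMeasurePreserving (measurePreserving_perm m σ)).continuous

instance (m : ℝ) (k : ℕ) : CompleteSpace (symmSpace m k) :=
  (isClosed_symmSpace m k).completeSpace_coe

/-- The bosonic Fock space: the Hilbert sum of the symmetric `k`-particle spaces. -/
abbrev Fock (m : ℝ) : Type := lp (fun k : ℕ => symmSpace m k) 2

/-- The `k`-particle wave function of a Fock vector. -/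
def Fock.wave {m : ℝ} (Ψ : Fock m) (k : ℕ) : (Fin k → E3) → ℂ :=
  ((Ψ k : symmSpace m k) : Lp ℂ 2 (shellMeasurePi m k))

theorem Fock.wave_add {m : ℝ} (Ψ Φ : Fock m) (k : ℕ) :
    (Ψ + Φ).wave k =ᵐ[shellMeasurePi m k] Ψ.wave k + Φ.wave k :=
  Lp.coeFn_add _ _

theorem Fock.wave_smul {m : ℝ} (c : ℂ) (Ψ : Fock m) (k : ℕ) :
    (c • Ψ).wave k =ᵐ[shellMeasurePi m k] c • Ψ.wave k :=
  Lp.coeFn_smul _ _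

theorem Fock.wave_zero (m : ℝ) (k : ℕ) :
    (0 : Fock m).wave k =ᵐ[shellMeasurePi m k] 0 :=
  Lp.coeFn_zero _ _ _

theorem ae_ae_cons (m : ℝ) {k : ℕ} {Q : (Fin (k + 1) → E3) → Prop}
    (h : ∀ᵐ p ∂(shellMeasurePi m (k + 1)), Q p) :
    ∀ᵐ q ∂(shellMeasurePi m k), ∀ᵐ p ∂(shellMeasure m), Q (Fin.cons p q) := by
  have h1 := (measurePreserving_piFinSuccAbove (fun _ : Fin (k + 1) => shellMeasure m) 0).symm
  have h2 := h1.quasiMeasurePreserving.ae h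
  have h3 := (Measure.measurePreserving_swap (μ := shellMeasurePi m k)
    (ν := shellMeasure m)).quasiMeasurePreserving.ae h2
  have h4 := Measure.ae_ae_of_ae_prod h3
  filter_upwards [h4] with q hq
  filter_upwards [hq] with p hp
  simpa [MeasurableEquiv.piFinSuccAbove, Fin.insertNthEquiv] using hp

/-- The graph of the operator `∫ d³𝐩/(2ω_𝐩) c(𝐩) a_c(𝐩)`, where `a_c(𝐩)` is the covariant
annihilation operator with sharp momentum. It sends `Ψ` to the Fock vector `Φ` with
`Φ_k(𝐩₁,…,𝐩_k) = √(k+1) ∫ d³𝐩/(2ω_𝐩) c(𝐩) Ψ_{k+1}(𝐩,𝐩₁,…,𝐩_k)`,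
whenever these integrals converge and define a Fock vector. -/
def annihilationGraph (m : ℝ) (c : E3 → ℂ) : Submodule ℂ (Fock m × Fock m) where
  carrier := {X | ∀ k : ℕ, ∀ᵐ q ∂(shellMeasurePi m k),
    Integrable (fun p => c p * X.1.wave (k + 1) (Fin.cons p q)) (shellMeasure m) ∧
    X.2.wave k q = (√((k : ℝ) + 1) : ℂ) *
      ∫ p, c p * X.1.wave (k + 1) (Fin.cons p q) ∂(shellMeasure m)}
  zero_mem' := by
    intro k
    filter_upwards [ae_ae_cons m (Fock.wave_zero m (k + 1)), Fock.wave_zero m k] with q h1 h2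
    have h3 : (fun p => c p * (0 : Fock m).wave (k + 1) (Fin.cons p q))
        =ᵐ[shellMeasure m] fun _ => 0 := by
      filter_upwards [h1] with p hp
      rw [hp]; simp
    refine ⟨(integrable_congr h3).2 (integrable_zero _ _ _), ?_⟩
    simp only [Prod.fst_zero, Prod.snd_zero]
    rw [integral_congr_ae h3, h2]; simp
  add_mem' := by
    intro X Y hX hY k
    filter_upwards [hX k, hY k, ae_ae_cons m (Fock.wave_add X.1 Y.1 (k + 1)),
      Fock.wave_add X.2 Y.2 k] with q hXq hYq h1 h2
    have h3 : (fun p => c p * (X.1 + Y.1).wave (k + 1) (Fin.cons p q))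
        =ᵐ[shellMeasure m] fun p => c p * X.1.wave (k + 1) (Fin.cons p q) +
          c p * Y.1.wave (k + 1) (Fin.cons p q) := by
      filter_upwards [h1] with p hp
      rw [hp, Pi.add_apply, mul_add]
    refine ⟨(integrable_congr h3).2 (hXq.1.add hYq.1), ?_⟩
    simp only [Prod.fst_add, Prod.snd_add]
    rw [integral_congr_ae h3, h2, integral_add hXq.1 hYq.1, Pi.add_apply, hXq.2, hYq.2, mul_add]
  smul_mem' := by
    intro a X hX k
    filter_upwards [hX k, ae_ae_cons m (Fock.wave_smul a X.1 (k + 1)),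
      Fock.wave_smul a X.2 k] with q hXq h1 h2
    have h3 : (fun p => c p * (a • X.1).wave (k + 1) (Fin.cons p q))
        =ᵐ[shellMeasure m] fun p => a * (c p * X.1.wave (k + 1) (Fin.cons p q)) := by
      filter_upwards [h1] with p hp
      rw [hp, Pi.smul_apply, smul_eq_mul]; ring
    refine ⟨(integrable_congr h3).2 (hXq.1.const_mul a), ?_⟩
    simp only [Prod.smul_fst, Prod.smul_snd]
    rw [integral_congr_ae h3, h2, integral_const_mul, Pi.smul_apply, hXq.2, smul_eq_mul]; ring

theorem annihilationGraph_functional (m : ℝ) (c : E3 → ℂ) (X : Fock m × Fock m)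
    (hX : X ∈ annihilationGraph m c) (h0 : X.1 = 0) : X.2 = 0 := by
  have key : ∀ k, X.2 k = 0 := by
    intro k
    apply Subtype.ext
    refine Lp.ext ?_
    refine EventuallyEq.trans ?_ (Lp.coeFn_zero ℂ 2 (shellMeasurePi m k)).symm
    have hk := hX k
    filter_upwards [hk, ae_ae_cons m (Fock.wave_zero m (k + 1))] with q hq h1
    have h3 : (fun p => c p * X.1.wave (k + 1) (Fin.cons p q))
        =ᵐ[shellMeasure m] fun _ => 0 := by
      filter_upwards [h1] with p hp
      rw [h0, hp]; simp
    have h4 := hq.2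
    rw [integral_congr_ae h3] at h4
    simpa [Fock.wave] using h4
  exact lp.ext (funext key)

/-- The (unbounded) operator `∫ d³𝐩/(2ω_𝐩) c(𝐩) a_c(𝐩)` on its maximal domain. For square-integrable
`f` the annihilation operator `a_c(f)` is the case `c = conj f`. -/
def annihilation (m : ℝ) (c : E3 → ℂ) : Fock m →ₗ.[ℂ] Fock m :=
  (annihilationGraph m c).toLinearPMap

theorem annihilation_graph (m : ℝ) (c : E3 → ℂ) :
    (annihilation m c).graph = annihilationGraph m c :=
  Submodule.toLinearPMap_graph_eq _ (fun X hX h0 => annihilationGraph_functional m c X hX h0)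

/-- The operator `∫ d³𝐩 c(𝐩) a(𝐩)` with the non-covariant `a(𝐩) = a_c(𝐩) / √(2ω_𝐩)`. -/
def annihilationNC (m : ℝ) (c : E3 → ℂ) : Fock m →ₗ.[ℂ] Fock m :=
  annihilation m (fun p => (2 * omega m p : ℝ) * (c p / (√(2 * omega m p) : ℝ)))

/-- The localized wave function
`Ψ_{𝐱,x⁰}(𝐩) = (2π)^(-3/2) e^{i p·x} (2ω_𝐩)^{1/2}`, with `p = (ω_𝐩, 𝐩)`. -/
def localizedWave (m : ℝ) (x : SpaceTime) (p : E3) : ℂ :=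
  (((2 * π) ^ (-(3 / 2) : ℝ) : ℝ) : ℂ) * Complex.exp (Complex.I * (shellDot m p x : ℝ)) *
    (√(2 * omega m p) : ℝ)

/-- `φ₁(x) = ∫ d³𝐩/(2ω_𝐩) conj Ψ_{𝐱,x⁰}(𝐩) a_c(𝐩)`. -/
def phi1 (m : ℝ) (x : SpaceTime) : Fock m →ₗ.[ℂ] Fock m :=
  annihilation m (fun p => (starRingEnd ℂ) (localizedWave m x p))

/-- The coordinate space annihilation operator
`ã(𝐱) = (2π)^(-3/2) ∫ d³𝐩 e^{i 𝐩·𝐱} a(𝐩)` (Euclidean product in the exponent). -/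
def aTilde (m : ℝ) (x : E3) : Fock m →ₗ.[ℂ] Fock m :=
  annihilationNC m (fun p => (((2 * π) ^ (-(3 / 2) : ℝ) : ℝ) : ℂ) *
    Complex.exp (Complex.I * (inner ℝ p x : ℝ)))

/-- The finite-particle vectors whose wave functions are Schwartz functions. -/
def schwartzCore (m : ℝ) : Set (Fock m) :=
  {Ψ | (∃ N : ℕ, ∀ k, N ≤ k → Ψ k = 0) ∧
    ∀ k, ∃ g : SchwartzMap (Fin k → E3) ℂ, Ψ.wave k =ᵐ[shellMeasurePi m k] g}

/-- The rotation of `ℝ³` given by a matrix in `SO(3)`. -/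
def rot (R : Matrix.specialOrthogonalGroup (Fin 3) ℝ) : E3 ≃ₗᵢ[ℝ] E3 :=
  Unitary.linearIsometryEquiv
    ⟨Matrix.toEuclideanCLM (𝕜 := ℝ) (R : Matrix (Fin 3) (Fin 3) ℝ),
      Unitary.map_mem (Matrix.toEuclideanCLM (𝕜 := ℝ) (n := Fin 3)) R.2.1⟩

theorem rot_apply (R : Matrix.specialOrthogonalGroup (Fin 3) ℝ) (p : E3) :
    rot R p = WithLp.toLp 2 ((R : Matrix (Fin 3) (Fin 3) ℝ).mulVec p.ofLp) := rfl

theorem omega_isometry (m : ℝ) (e : E3 ≃ₗᵢ[ℝ] E3) (p : E3) : omega m (e p) = omega m p := by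
  simp [omega]

theorem measurePreserving_isometry (m : ℝ) (e : E3 ≃ₗᵢ[ℝ] E3) :
    MeasurePreserving e (shellMeasure m) (shellMeasure m) := by
  refine ⟨e.continuous.measurable, ?_⟩
  have hv := e.measurePreserving
  ext s hs
  rw [Measure.map_apply e.continuous.measurable hs]
  unfold shellMeasure
  rw [withDensity_apply _ hs, withDensity_apply _ (e.continuous.measurable hs)]
  have := hv.setLIntegral_comp_preimage hs (f := fun p => ENNReal.ofReal (1 / (2 * omega m p)))
    (by have := (continuous_omega m).measurable; fun_prop)
  rw [← this]
  simp only [omega_isometry]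

theorem measurePreserving_rotPi (m : ℝ) (e : E3 ≃ₗᵢ[ℝ] E3) (k : ℕ) :
    MeasurePreserving (fun (p : Fin k → E3) j => e (p j))
      (shellMeasurePi m k) (shellMeasurePi m k) :=
  measurePreserving_pi _ _ (fun _ => measurePreserving_isometry m e)

/-- The phase `e^{i(p₁ + ⋯ + p_k)·y}` of `k` on-shell momenta. -/
def phase (m : ℝ) (y : SpaceTime) {k : ℕ} (p : Fin k → E3) : ℂ :=
  Complex.exp (Complex.I * ((∑ j, shellDot m (p j) y : ℝ) : ℂ))

theorem norm_phase (m : ℝ) (y : SpaceTime) {k : ℕ} (p : Fin k → E3) : ‖phase m y p‖ = 1 := by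
  unfold phase; rw [mul_comm]; exact Complex.norm_exp_ofReal_mul_I _

theorem continuous_phase (m : ℝ) (y : SpaceTime) (k : ℕ) :
    Continuous (fun p : Fin k → E3 => phase m y p) := by
  unfold phase
  have := continuous_shellDot m y
  fun_prop

theorem memLp_act (m : ℝ) (y : SpaceTime) (e : E3 ≃ₗᵢ[ℝ] E3) {k : ℕ}
    (f : Lp ℂ 2 (shellMeasurePi m k)) :
    MemLp (fun p => phase m y p * f (fun j => e.symm (p j))) 2 (shellMeasurePi m k) := by
  have h1 : MemLp (fun p => f (fun j => e.symm (p j))) 2 (shellMeasurePi m k) :=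
    (Lp.memLp f).comp_measurePreserving (measurePreserving_rotPi m e.symm k)
  refine h1.of_le ((continuous_phase m y k).aestronglyMeasurable.mul h1.1) ?_
  exact ae_of_all _ fun p => by simp [norm_phase]

/-- The `k`-particle transformation
`Ψ(𝐩₁,…,𝐩_k) ↦ e^{i(p₁+⋯+p_k)·y} Ψ(R⁻¹𝐩₁,…,R⁻¹𝐩_k)` on square-integrable functions. -/
def act (m : ℝ) (y : SpaceTime) (e : E3 ≃ₗᵢ[ℝ] E3) (k : ℕ)
    (f : Lp ℂ 2 (shellMeasurePi m k)) : Lp ℂ 2 (shellMeasurePi m k) :=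
  (memLp_act m y e f).toLp

theorem coeFn_act (m : ℝ) (y : SpaceTime) (e : E3 ≃ₗᵢ[ℝ] E3) (k : ℕ)
    (f : Lp ℂ 2 (shellMeasurePi m k)) :
    act m y e k f =ᵐ[shellMeasurePi m k] fun p => phase m y p * f (fun j => e.symm (p j)) :=
  MemLp.coeFn_toLp _

theorem act_add (m : ℝ) (y : SpaceTime) (e : E3 ≃ₗᵢ[ℝ] E3) (k : ℕ)
    (f g : Lp ℂ 2 (shellMeasurePi m k)) : act m y e k (f + g) = act m y e k f + act m y e k g := by
  refine Lp.ext ?_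
  filter_upwards [coeFn_act m y e k (f + g), coeFn_act m y e k f, coeFn_act m y e k g,
    Lp.coeFn_add (act m y e k f) (act m y e k g),
    (measurePreserving_rotPi m e.symm k).quasiMeasurePreserving.ae (Lp.coeFn_add f g)]
    with p h1 h2 h3 h4 h5
  rw [h1, h4, Pi.add_apply, h2, h3, h5, Pi.add_apply, mul_add]

theorem act_smul (m : ℝ) (y : SpaceTime) (e : E3 ≃ₗᵢ[ℝ] E3) (k : ℕ) (c : ℂ)
    (f : Lp ℂ 2 (shellMeasurePi m k)) : act m y e k (c • f) = c • act m y e k f := by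
  refine Lp.ext ?_
  filter_upwards [coeFn_act m y e k (c • f), coeFn_act m y e k f,
    Lp.coeFn_smul c (act m y e k f),
    (measurePreserving_rotPi m e.symm k).quasiMeasurePreserving.ae (Lp.coeFn_smul c f)]
    with p h1 h2 h3 h4
  rw [h1, h3, Pi.smul_apply, h2, h4, Pi.smul_apply, smul_eq_mul, smul_eq_mul]; ring

theorem norm_act (m : ℝ) (y : SpaceTime) (e : E3 ≃ₗᵢ[ℝ] E3) (k : ℕ)
    (f : Lp ℂ 2 (shellMeasurePi m k)) : ‖act m y e k f‖ = ‖f‖ := by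
  rw [← Lp.norm_compMeasurePreserving f (measurePreserving_rotPi m e.symm k)]
  simp only [Lp.norm_def]
  congr 1
  refine eLpNorm_congr_norm_ae ?_
  filter_upwards [coeFn_act m y e k f,
    Lp.coeFn_compMeasurePreserving f (measurePreserving_rotPi m e.symm k)] with p h1 h2
  rw [h1, h2, norm_mul, norm_phase, one_mul]; rfl

theorem act_mem_symmSpace (m : ℝ) (y : SpaceTime) (e : E3 ≃ₗᵢ[ℝ] E3) (k : ℕ)
    {f : Lp ℂ 2 (shellMeasurePi m k)} (hf : f ∈ symmSpace m k) :
    act m y e k f ∈ symmSpace m k := by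
  intro σ
  have h1 := coeFn_act m y e k f
  filter_upwards [h1, (measurePreserving_perm m σ).quasiMeasurePreserving.ae h1,
    (measurePreserving_rotPi m e.symm k).quasiMeasurePreserving.ae (hf σ)] with p h2 h3 h4
  rw [h3, h2, ← h4]
  have h5 : phase m y (p ∘ σ) = phase m y p := by
    unfold phase
    congr 3
    exact Equiv.sum_comp σ (fun j => shellDot m (p j) y)
  rw [h5]; rfl

/-- The inverse transformation: `(y, R)⁻¹ = (-R⁻¹y, R⁻¹)`. -/
theorem act_act_inv (m : ℝ) (y : SpaceTime) (e : E3 ≃ₗᵢ[ℝ] E3) (k : ℕ)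
    (f : Lp ℂ 2 (shellMeasurePi m k)) :
    act m y e k (act m (-y.1, -e.symm y.2) e.symm k f) = f := by
  refine Lp.ext ?_
  filter_upwards [coeFn_act m y e k (act m (-y.1, -e.symm y.2) e.symm k f),
    (measurePreserving_rotPi m e.symm k).quasiMeasurePreserving.ae
      (coeFn_act m (-y.1, -e.symm y.2) e.symm k f)] with p h1 h2
  rw [h1, h2, ← mul_assoc]
  have h3 : phase m y p * phase m (-y.1, -e.symm y.2) (fun j => e.symm (p j)) = 1 := by
    unfold phase
    rw [← Complex.exp_add, ← mul_add, ← Complex.ofReal_add, ← Finset.sum_add_distrib]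
    simp [shellDot, omega_isometry]
  rw [h3, one_mul]
  simp

/-- The `k`-particle unitary. -/
def unitaryK (m : ℝ) (y : SpaceTime) (e : E3 ≃ₗᵢ[ℝ] E3) (k : ℕ) :
    symmSpace m k →ₗᵢ[ℂ] symmSpace m k where
  toFun f := ⟨act m y e k f, act_mem_symmSpace m y e k f.2⟩
  map_add' f g := Subtype.ext (act_add m y e k f g)
  map_smul' c f := Subtype.ext (act_smul m y e k c f)
  norm_map' f := norm_act m y e k f

theorem memlp_unitaryK (m : ℝ) (y : SpaceTime) (e : E3 ≃ₗᵢ[ℝ] E3) (Ψ : Fock m) :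
    Memℓp (fun k => unitaryK m y e k (Ψ k)) 2 := by
  have h := lp.memℓp Ψ
  have h2 : 0 < (2 : ENNReal).toReal := by norm_num
  rw [memℓp_gen_iff h2] at h ⊢
  simpa using h

def fockIsometry (m : ℝ) (y : SpaceTime) (e : E3 ≃ₗᵢ[ℝ] E3) : Fock m →ₗᵢ[ℂ] Fock m where
  toFun Ψ := ⟨fun k => unitaryK m y e k (Ψ k), memlp_unitaryK m y e Ψ⟩
  map_add' Ψ Φ := lp.ext (funext fun k => (unitaryK m y e k).map_add (Ψ k) (Φ k))
  map_smul' c Ψ := lp.ext (funext fun k => (unitaryK m y e k).map_smul c (Ψ k))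
  norm_map' Ψ := by
    have h2 : 0 < (2 : ENNReal).toReal := by norm_num
    rw [lp.norm_eq_tsum_rpow h2, lp.norm_eq_tsum_rpow h2]
    simp

theorem fockIsometry_surjective (m : ℝ) (y : SpaceTime) (e : E3 ≃ₗᵢ[ℝ] E3) :
    Function.Surjective (fockIsometry m y e) := fun Φ =>
  ⟨fockIsometry m (-y.1, -e.symm y.2) e.symm Φ,
    lp.ext (funext fun k => Subtype.ext (act_act_inv m y e k (Φ k)))⟩

/-- The unitary operator `U(y, Λ_R)` on Fock space that represents the rotation `R` followed by the
space-time translation `y`: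
`(U(y, Λ_R) Ψ)_k(𝐩₁,…,𝐩_k) = e^{i(p₁+⋯+p_k)·y} Ψ_k(R⁻¹𝐩₁,…,R⁻¹𝐩_k)`,
so that `U(y, Λ_R) a_c(𝐩) U(y, Λ_R)⁻¹ = e^{-i(Λ_R p)·y} a_c(R𝐩)`. -/
def U (m : ℝ) (y : SpaceTime) (R : Matrix.specialOrthogonalGroup (Fin 3) ℝ) :
    Fock m ≃ₗᵢ[ℂ] Fock m :=
  LinearIsometryEquiv.ofSurjective (fockIsometry m y (rot R))
    (fockIsometry_surjective m y (rot R))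

theorem U_wave (m : ℝ) (y : SpaceTime) (R : Matrix.specialOrthogonalGroup (Fin 3) ℝ)
    (Ψ : Fock m) (k : ℕ) :
    (U m y R Ψ).wave k =ᵐ[shellMeasurePi m k]
      fun p => phase m y p * Ψ.wave k (fun j => (rot R).symm (p j)) :=
  coeFn_act m y (rot R) k (Ψ k)

/-- The conjugated operator `V A V⁻¹`, with domain `V (dom A)`. -/
def conjugate {m : ℝ} (V : Fock m ≃ₗᵢ[ℂ] Fock m) (A : Fock m →ₗ.[ℂ] Fock m) :
    Fock m →ₗ.[ℂ] Fock m where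
  domain := A.domain.comap V.symm.toLinearEquiv.toLinearMap
  toFun := V.toLinearEquiv.toLinearMap ∘ₗ A.toFun ∘ₗ
    V.symm.toLinearEquiv.toLinearMap.submoduleComap A.domain

theorem conjugate_apply {m : ℝ} (V : Fock m ≃ₗᵢ[ℂ] Fock m) (A : Fock m →ₗ.[ℂ] Fock m)
    (Ψ : (conjugate V A).domain) : conjugate V A Ψ = V (A ⟨V.symm Ψ, Ψ.2⟩) := rfl

/-- The modified Bessel function of the second kind, for `Re w > 0`. -/
def besselK (ν : ℝ) (w : ℂ) : ℂ :=
  ∫ s in Set.Ioi (0 : ℝ), Complex.exp (-w * (Real.cosh s : ℝ)) * (Real.cosh (ν * s) : ℝ)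

/-- The kernel `(i t / 2π²) m² K₂(m √(|𝐯|² - t²)) / (|𝐯|² - t²)` (principal square root), as a
function of a possibly complex time `t`. -/
def timeKernel (m : ℝ) (t : ℂ) (v : E3) : ℂ :=
  Complex.I * t / (2 * (π : ℂ) ^ 2) *
    ((m : ℂ) ^ 2 * besselK 2 (m * Complex.sqrt ((‖v‖ : ℂ) ^ 2 - t ^ 2)) /
      ((‖v‖ : ℂ) ^ 2 - t ^ 2))

end ScalarField

end

/-! For an imaginary time `t = -is` with `s > 0`, subordination writes `e^{-sω}` as a superposition
of Gaussians in the momentum. Transforming these one by one leaves an integral representation of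
`K₂`, so `timeKernel m (-is)` is the inverse Fourier transform of `e^{-sω}`. Both sides are analytic
in `t`, hence `timeKernel m t` is the inverse Fourier transform of `e^{-itω}` for every `t` in the
open lower half-plane. As the kernel is integrable there, Fourier inversion gives
`∫ timeKernel m t v · e^{-i𝐩·𝐯} d𝐯 = e^{-itω}`: convolution with the kernel evolves a plane wave by
the complex time `t`.

The coordinate operator `ã(𝐱)` is `φ₁(0, 𝐱)`, and `φ₁` is covariant by a change of variables on the
mass shell, so the left-hand side of the convolution formula is `φ₁(y⁰, R𝐱 + 𝐲)Ψ`. On a fixed vector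
`Ψ` of the Schwartz core, `φ₁(x)Ψ` is the image of the plane wave at `x`, divided by `ω`, under a
continuous linear map from the bounded continuous functions of the momentum to Fock space. Bochner
integrability and the limit `ε → 0` are thereby reduced to plane waves; after the division by `ω`
these are Lipschitz in time and position for the uniform norm, up to the real axis. -/

noncomputable section

namespace ScalarField

/-! ### Bessel functions of the second kind -/

theorem sq_div_four_le_cosh (t : ℝ) : t ^ 2 / 4 ≤ Real.cosh t := by
  have h := Real.quadratic_le_exp_of_nonneg (abs_nonneg t)
  rw [← Real.cosh_abs, Real.cosh_eq, ← sq_abs]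
  linarith [abs_nonneg t, Real.exp_pos (-|t|)]

theorem integrable_exp_mul_sub_mul_cosh {x : ℝ} (hx : 0 < x) (ν : ℝ) :
    Integrable fun t : ℝ => Real.exp (ν * t - x * Real.cosh t) := by
  have hgauss := (integrable_cexp_quadratic (b := (x / 4 : ℝ)) (by simpa using hx) ν 0).norm
  refine hgauss.mono' (by fun_prop) (ae_of_all _ fun t => ?_)
  rw [Complex.norm_exp, Real.norm_of_nonneg (Real.exp_nonneg _)]
  norm_cast
  gcongr
  nlinarith [sq_div_four_le_cosh t]

theorem exp_neg_mul_cosh_mul_cosh (x ν t : ℝ) :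
    Real.exp (-x * Real.cosh t) * Real.cosh (ν * t) =
      2⁻¹ * (Real.exp (ν * t - x * Real.cosh t) + Real.exp (-ν * t - x * Real.cosh t)) := by
  rw [Real.cosh_eq (ν * t), sub_eq_neg_add, sub_eq_neg_add, Real.exp_add, Real.exp_add, neg_mul,
    neg_mul]
  ring

theorem integrable_exp_neg_mul_cosh_mul_cosh {x : ℝ} (hx : 0 < x) (ν : ℝ) :
    Integrable fun t : ℝ => Real.exp (-x * Real.cosh t) * Real.cosh (ν * t) := by
  simp_rw [exp_neg_mul_cosh_mul_cosh]
  exact ((integrable_exp_mul_sub_mul_cosh hx ν).add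
    (integrable_exp_mul_sub_mul_cosh hx (-ν))).const_mul _

theorem integral_exp_neg_mul_cosh_mul_cosh {x : ℝ} (hx : 0 < x) (ν : ℝ) :
    ∫ t : ℝ, Real.exp (-x * Real.cosh t) * Real.cosh (ν * t) =
      ∫ t : ℝ, Real.exp (ν * t - x * Real.cosh t) := by
  have hreflect : ∫ t : ℝ, Real.exp (-ν * t - x * Real.cosh t) =
      ∫ t : ℝ, Real.exp (ν * t - x * Real.cosh t) := by
    rw [← integral_neg_eq_self]
    simp
  simp_rw [exp_neg_mul_cosh_mul_cosh]
  rw [integral_const_mul, integral_add (integrable_exp_mul_sub_mul_cosh hx ν)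
    (integrable_exp_mul_sub_mul_cosh hx (-ν)), hreflect]
  ring

theorem besselK_ofReal (ν x : ℝ) : besselK ν x =
    ((∫ s in Set.Ioi (0 : ℝ), Real.exp (-x * Real.cosh s) * Real.cosh (ν * s) : ℝ) : ℂ) := by
  rw [besselK, ← integral_complex_ofReal]
  push_cast
  rfl

theorem two_mul_besselK_ofReal {x : ℝ} (hx : 0 < x) (ν : ℝ) :
    2 * besselK ν x = ((∫ t : ℝ, Real.exp (ν * t - x * Real.cosh t) : ℝ) : ℂ) := by
  rw [besselK_ofReal, ← integral_exp_neg_mul_cosh_mul_cosh hx]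
  norm_cast
  rw [← integral_comp_abs]
  refine integral_congr_ae (ae_of_all _ fun t => ?_)
  dsimp only
  rw [Real.cosh_abs, ← Real.cosh_abs (ν * t), ← Real.cosh_abs (ν * |t|), abs_mul, abs_mul, abs_abs]

theorem besselK_neg (ν : ℝ) (w : ℂ) : besselK (-ν) w = besselK ν w := by
  simp [besselK]

theorem integral_cosh_smul_comp_sinh {F : Type*} [NormedAddCommGroup F] [NormedSpace ℝ F]
    (g : ℝ → F) : ∫ t, Real.cosh t • g (Real.sinh t) = ∫ w, g w := by
  have hsubst := integral_image_eq_integral_abs_deriv_smul MeasurableSet.univ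
    (fun t _ => (Real.hasDerivAt_sinh t).hasDerivWithinAt) Real.sinh_injective.injOn g
  simpa [Real.sinh_surjective.range_eq, abs_of_pos (Real.cosh_pos _)] using hsubst.symm

theorem besselK_one_half {x : ℝ} (hx : 0 < x) :
    besselK (1 / 2) x = (√(π / (2 * x)) * Real.exp (-x) : ℝ) := by
  have hpoint : ∀ t : ℝ, Real.exp (-x * Real.cosh t) * Real.cosh (1 / 2 * t) =
      Real.exp (-x) * (Real.cosh (t / 2) • Real.exp (-(2 * x) * Real.sinh (t / 2) ^ 2)) := by
    intro t
    have hcosh : Real.cosh t = 1 + 2 * Real.sinh (t / 2) ^ 2 := by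
      conv_lhs => rw [← mul_div_cancel₀ t (two_ne_zero' ℝ), Real.cosh_two_mul]
      linarith [Real.cosh_sq (t / 2)]
    rw [hcosh, show -x * (1 + 2 * Real.sinh (t / 2) ^ 2) =
      -x + -(2 * x) * Real.sinh (t / 2) ^ 2 by ring, Real.exp_add, div_mul_eq_mul_div, one_mul,
      smul_eq_mul]
    ring
  have hint : ∫ t : ℝ, Real.exp (1 / 2 * t - x * Real.cosh t) =
      2 * (√(π / (2 * x)) * Real.exp (-x)) := by
    rw [← integral_exp_neg_mul_cosh_mul_cosh hx]
    simp_rw [hpoint]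
    rw [integral_const_mul, Measure.integral_comp_div
        (fun t => Real.cosh t • Real.exp (-(2 * x) * Real.sinh t ^ 2)),
      integral_cosh_smul_comp_sinh fun w => Real.exp (-(2 * x) * w ^ 2), integral_gaussian]
    simp only [abs_two, smul_eq_mul]
    ring
  have htwo := two_mul_besselK_ofReal hx (1 / 2)
  rw [hint, Complex.ofReal_mul, Complex.ofReal_ofNat] at htwo
  exact mul_left_cancel₀ two_ne_zero htwo

/-- The substitution `u = t + log (β / α)` makes the exponent symmetric. -/
theorem exp_mul_sub_exp_add_exp_eq {α β : ℝ} (hα : 0 < α) (hβ : 0 < β) (ν u : ℝ) :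
    Real.exp (ν * u - (α ^ 2 * Real.exp u + β ^ 2 * Real.exp (-u))) =
      (β / α) ^ ν * Real.exp (ν * (u - Real.log (β / α)) -
        2 * α * β * Real.cosh (u - Real.log (β / α))) := by
  have hratio : 0 < β / α := div_pos hβ hα
  have hcosh : 2 * Real.cosh (u - Real.log (β / α)) =
      α / β * Real.exp u + β / α * Real.exp (-u) := by
    rw [Real.cosh_eq, neg_sub, Real.exp_sub, sub_eq_add_neg (Real.log _), Real.exp_add,
      Real.exp_log hratio]
    field_simp
  rw [Real.rpow_def_of_pos hratio, ← Real.exp_add,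
    show 2 * α * β * Real.cosh (u - Real.log (β / α)) =
      α * β * (2 * Real.cosh (u - Real.log (β / α))) by ring, hcosh]
  congr 1
  field_simp
  ring

theorem integrable_exp_mul_sub_exp_add_exp {α β : ℝ} (hα : 0 < α) (hβ : 0 < β) (ν : ℝ) :
    Integrable fun u : ℝ =>
      Real.exp (ν * u - (α ^ 2 * Real.exp u + β ^ 2 * Real.exp (-u))) := by
  simp_rw [exp_mul_sub_exp_add_exp_eq hα hβ]
  exact ((integrable_exp_mul_sub_mul_cosh (by positivity) ν).comp_sub_right _).const_mul _

theorem integral_exp_mul_sub_exp_add_exp {α β : ℝ} (hα : 0 < α) (hβ : 0 < β) (ν : ℝ) :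
    ((∫ u : ℝ, Real.exp (ν * u - (α ^ 2 * Real.exp u + β ^ 2 * Real.exp (-u))) : ℝ) : ℂ) =
      2 * ((β / α) ^ ν : ℝ) * besselK ν (2 * α * β : ℝ) := by
  simp_rw [exp_mul_sub_exp_add_exp_eq hα hβ]
  rw [integral_const_mul,
    integral_sub_right_eq_self fun t => Real.exp (ν * t - 2 * α * β * Real.cosh t),
    Complex.ofReal_mul, ← two_mul_besselK_ofReal (by positivity)]
  ring

/-- Subordination: `e^{-s a}` is a superposition of the Gaussians `e^{-a² e^u}`. -/
theorem integral_exp_neg_half_mul_sub {s a : ℝ} (hs : 0 < s) (ha : 0 < a) :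
    ∫ u : ℝ, Real.exp (-(1 / 2) * u - (a ^ 2 * Real.exp u + (s / 2) ^ 2 * Real.exp (-u))) =
      2 * √π / s * Real.exp (-(s * a)) := by
  have hschlafli := integral_exp_mul_sub_exp_add_exp ha (half_pos hs) (-(1 / 2))
  rw [besselK_neg, besselK_one_half (by positivity)] at hschlafli
  have hroots : (s / 2 / a) ^ (-(1 / 2) : ℝ) * √(π / (2 * (2 * a * (s / 2)))) = √π / s := by
    rw [Real.rpow_neg (by positivity), ← Real.sqrt_eq_rpow, ← Real.sqrt_inv,
      ← Real.sqrt_mul (by positivity), ← Real.sqrt_sq hs.le, ← Real.sqrt_div' _ (sq_nonneg _),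
      Real.sqrt_sq hs.le]
    congr 1
    field_simp
  norm_cast at hschlafli
  rw [hschlafli, mul_assoc, ← mul_assoc ((s / 2 / a) ^ _), hroots]
  ring_nf

theorem norm_besselK_le {a : ℝ} (ha : 0 < a) (ν : ℝ) {w : ℂ} (haw : a ≤ w.re) :
    ‖besselK ν w‖ ≤ Real.exp (-(w.re - a)) *
      ∫ s in Set.Ioi (0 : ℝ), Real.exp (-a * Real.cosh s) * Real.cosh (ν * s) := by
  rw [← integral_const_mul]
  refine norm_integral_le_of_norm_le
    ((integrable_exp_neg_mul_cosh_mul_cosh ha ν).const_mul _).restrict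
    (ae_of_all _ fun s => ?_)
  rw [norm_mul, Complex.norm_exp, Complex.norm_real, Real.norm_of_nonneg (Real.cosh_pos _).le,
    ← mul_assoc, ← Real.exp_add, Complex.re_mul_ofReal, Complex.neg_re]
  gcongr
  nlinarith [Real.one_le_cosh s]

theorem mul_exp_neg_le {a δ : ℝ} (hδ : 0 < δ) : a * Real.exp (-δ * a) ≤ δ⁻¹ := by
  have hle := Real.mul_exp_neg_le_exp_neg_one (δ * a)
  have hone : Real.exp (-1) ≤ 1 := Real.exp_le_one_iff.2 (by norm_num)
  rw [← one_div, le_div_iff₀ hδ, neg_mul]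
  linarith

theorem differentiableOn_integral_cexp_neg_mul_smul {α E : Type*} [MeasurableSpace α]
    {μ : Measure α} [NormedAddCommGroup E] [NormedSpace ℂ E] {a : α → ℝ} {b : α → E}
    (ha : Measurable a) (ha0 : ∀ x, 0 ≤ a x) (hb : AEStronglyMeasurable b μ)
    (hint : ∀ δ : ℝ, 0 < δ → Integrable (fun x => Real.exp (-δ * a x) * ‖b x‖) μ) :
    DifferentiableOn ℂ (fun τ : ℂ => ∫ x, Complex.exp (-τ * a x) • b x ∂μ) {τ | 0 < τ.re} := by
  have hmeas : ∀ τ : ℂ, AEStronglyMeasurable (fun x => Complex.exp (-τ * a x) • b x) μ :=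
    fun τ => AEStronglyMeasurable.smul (by fun_prop) hb
  have hnorm : ∀ (τ : ℂ) x, ‖Complex.exp (-τ * a x)‖ = Real.exp (-τ.re * a x) := by
    simp [Complex.norm_exp]
  intro τ hτ
  obtain ⟨δ, hδ, hδτ⟩ : ∃ δ : ℝ, 0 < δ ∧ δ + δ < τ.re :=
    ⟨τ.re / 3, div_pos hτ three_pos, by linarith [show 0 < τ.re from hτ]⟩
  have hnhds : {z : ℂ | δ + δ < z.re} ∈ 𝓝 τ :=
    (isOpen_lt continuous_const Complex.continuous_re).mem_nhds hδτ
  have hderiv_le : ∀ x, ∀ z ∈ {z : ℂ | δ + δ < z.re},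
      ‖(Complex.exp (-z * a x) * (-(a x : ℂ))) • b x‖ ≤
        δ⁻¹ * (Real.exp (-δ * a x) * ‖b x‖) := by
    intro x z hz
    rw [norm_smul, norm_mul, hnorm, norm_neg, Complex.norm_real, Real.norm_of_nonneg (ha0 x),
      ← mul_assoc]
    refine mul_le_mul_of_nonneg_right ?_ (norm_nonneg _)
    calc Real.exp (-z.re * a x) * a x
        ≤ Real.exp (-(δ + δ) * a x) * a x := by gcongr; exacts [ha0 x, ha0 x, hz.le]
      _ = a x * Real.exp (-δ * a x) * Real.exp (-δ * a x) := by
        rw [neg_add, add_mul, Real.exp_add]; ring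
      _ ≤ δ⁻¹ * Real.exp (-δ * a x) := by gcongr; exact mul_exp_neg_le hδ
  refine ((hasDerivAt_integral_of_dominated_loc_of_deriv_le
    (F := fun (τ : ℂ) x => Complex.exp (-τ * a x) • b x) hnhds (Eventually.of_forall hmeas) ?_ ?_
    (ae_of_all _ hderiv_le) ((hint δ hδ).const_mul _)
    (ae_of_all _ fun x z _ => ?_)).2).differentiableAt.differentiableWithinAt
  · refine (hint τ.re hτ).mono (hmeas τ) (ae_of_all _ fun x => ?_)
    rw [norm_smul, hnorm, norm_mul, norm_norm, Real.norm_of_nonneg (Real.exp_nonneg _)]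
  · exact AEStronglyMeasurable.smul (by fun_prop) hb
  · exact ((hasDerivAt_neg z).mul_const (a x : ℂ)).cexp.smul_const (b x) |>.congr_deriv (by simp)

theorem differentiableOn_besselK (ν : ℝ) : DifferentiableOn ℂ (besselK ν) {w | 0 < w.re} := by
  refine differentiableOn_integral_cexp_neg_mul_smul (a := Real.cosh)
    (b := fun s : ℝ => ((Real.cosh (ν * s) : ℝ) : ℂ)) Real.measurable_cosh
    (fun s => (Real.cosh_pos s).le) (by fun_prop) fun δ hδ => ?_
  simpa [Complex.norm_real, abs_of_pos (Real.cosh_pos _), -Complex.ofReal_cosh] using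
    (integrable_exp_neg_mul_cosh_mul_cosh hδ ν).restrict (s := Set.Ioi 0)

/-! ### The Fourier transform of `exp (-s √(‖p‖² + m²))` -/

theorem integrable_exp_neg_mul_norm {E : Type*} [NormedAddCommGroup E] [NormedSpace ℝ E]
    [FiniteDimensional ℝ E] [MeasurableSpace E] [BorelSpace E] (μ : Measure E)
    [μ.IsAddHaarMeasure] {δ : ℝ} (hδ : 0 < δ) :
    Integrable (fun x => Real.exp (-δ * ‖x‖)) μ := by
  set N := Module.finrank ℝ E + 1 with hN
  have hdecay : Integrable (fun x : E => (1 + ‖x‖) ^ (-(N : ℝ))) μ :=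
    integrable_one_add_norm (by simp [hN])
  refine (hdecay.const_mul (Real.exp δ * N.factorial / δ ^ N)).mono' (by fun_prop)
    (ae_of_all _ fun x => ?_)
  have hexp := Real.pow_div_factorial_le_exp (δ * (1 + ‖x‖)) (by positivity) N
  rw [Real.norm_of_nonneg (Real.exp_nonneg _), Real.rpow_neg (by positivity), Real.rpow_natCast,
    show -δ * ‖x‖ = δ - δ * (1 + ‖x‖) by ring, Real.exp_sub, div_le_iff₀ (Real.exp_pos _)]
  calc Real.exp δ = Real.exp δ * N.factorial / δ ^ N * ((1 + ‖x‖) ^ N)⁻¹ *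
        ((δ * (1 + ‖x‖)) ^ N / N.factorial) := by
        rw [mul_pow]
        field_simp
    _ ≤ _ := by gcongr

section FourierTransform

variable {V : Type*} [NormedAddCommGroup V] [InnerProductSpace ℝ V] [FiniteDimensional ℝ V]
  [MeasurableSpace V] [BorelSpace V]

theorem integrable_exp_neg_mul_sqrt_norm_sq_add {δ : ℝ} (hδ : 0 < δ) (m : ℝ) :
    Integrable fun p : V => Real.exp (-δ * √(‖p‖ ^ 2 + m ^ 2)) := by
  refine (integrable_exp_neg_mul_norm volume hδ).mono' (by fun_prop) (ae_of_all _ fun p => ?_)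
  rw [Real.norm_of_nonneg (Real.exp_nonneg _), neg_mul, neg_mul]
  gcongr
  exact Real.le_sqrt_of_sq_le (by linarith [sq_nonneg m])

theorem integral_cexp_inner_mul_exp_neg_mul_sq {b : ℝ} (hb : 0 < b) (v : V) :
    ∫ p : V, Complex.exp (Complex.I * (inner ℝ v p : ℝ)) * (Real.exp (-(b * ‖p‖ ^ 2)) : ℝ) =
      ((π / b) ^ (Module.finrank ℝ V / 2 : ℝ) * Real.exp (-(‖v‖ ^ 2 / (4 * b))) : ℝ) := by
  have hgauss := GaussianFourier.integral_cexp_neg_mul_sq_norm_add (b := b)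
    (by simpa using hb) Complex.I v
  rw [Complex.I_sq] at hgauss
  push_cast [Complex.ofReal_cpow (div_pos pi_pos hb).le]
  rw [← neg_div, ← neg_one_mul ((‖v‖ : ℂ) ^ 2), ← hgauss]
  simp_rw [← Complex.exp_add]
  refine integral_congr_ae (ae_of_all _ fun p => congrArg Complex.exp ?_)
  ring

theorem integral_cexp_inner_mul_exp_subordinator (m s u : ℝ) (v : V) :
    ∫ p : V, Complex.exp (Complex.I * (inner ℝ v p : ℝ)) *
      (Real.exp (-(1 / 2) * u - ((‖p‖ ^ 2 + m ^ 2) * Real.exp u +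
        (s / 2) ^ 2 * Real.exp (-u))) : ℝ) =
      (π ^ (Module.finrank ℝ V / 2 : ℝ) * Real.exp (-((Module.finrank ℝ V + 1) / 2) * u -
        (m ^ 2 * Real.exp u + (√(‖v‖ ^ 2 + s ^ 2) / 2) ^ 2 * Real.exp (-u))) : ℝ) := by
  have hsplit : ∀ p : V, Real.exp (-(1 / 2) * u - ((‖p‖ ^ 2 + m ^ 2) * Real.exp u +
      (s / 2) ^ 2 * Real.exp (-u))) =
      Real.exp (-(1 / 2) * u - (m ^ 2 * Real.exp u + (s / 2) ^ 2 * Real.exp (-u))) *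
        Real.exp (-(Real.exp u * ‖p‖ ^ 2)) := fun p => by
    rw [← Real.exp_add]
    ring_nf
  have hpow : (π / Real.exp u) ^ (Module.finrank ℝ V / 2 : ℝ) =
      π ^ (Module.finrank ℝ V / 2 : ℝ) * Real.exp (-(u * (Module.finrank ℝ V / 2))) := by
    rw [Real.div_rpow pi_pos.le (Real.exp_nonneg u), ← Real.exp_mul, Real.exp_neg, div_eq_mul_inv]
  simp_rw [hsplit, Complex.ofReal_mul, mul_left_comm (Complex.exp _)]
  rw [integral_const_mul, integral_cexp_inner_mul_exp_neg_mul_sq (Real.exp_pos u), hpow,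
    ← Complex.ofReal_mul, ← Complex.ofReal_mul, mul_assoc, mul_left_comm (Real.exp _),
    ← Real.exp_add, ← Real.exp_add, div_pow (√_), Real.sq_sqrt (by positivity), Real.exp_neg u]
  congr 3
  field_simp
  ring

theorem integrable_cexp_inner_mul_exp_subordinator {m s : ℝ} (hm : 0 < m) (hs : 0 < s) (v : V) :
    Integrable (Function.uncurry fun (p : V) (u : ℝ) =>
      Complex.exp (Complex.I * (inner ℝ v p : ℝ)) *
        (Real.exp (-(1 / 2) * u - ((‖p‖ ^ 2 + m ^ 2) * Real.exp u +
          (s / 2) ^ 2 * Real.exp (-u))) : ℝ)) := by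
  have hω_sq : ∀ p : V, √(‖p‖ ^ 2 + m ^ 2) ^ 2 = ‖p‖ ^ 2 + m ^ 2 := fun p =>
    Real.sq_sqrt (by positivity)
  refine (integrable_prod_iff (Continuous.aestronglyMeasurable (by fun_prop))).2
    ⟨ae_of_all _ fun p => ?_, ?_⟩
  · have hfiber := integrable_exp_mul_sub_exp_add_exp (show 0 < √(‖p‖ ^ 2 + m ^ 2) by positivity)
      (half_pos hs) (-(1 / 2))
    rw [hω_sq] at hfiber
    exact hfiber.ofReal.const_mul (Complex.exp (Complex.I * (inner ℝ v p : ℝ)))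
  · have hfiber : ∀ p : V, ∫ u, Real.exp (-(1 / 2) * u - ((‖p‖ ^ 2 + m ^ 2) * Real.exp u +
        (s / 2) ^ 2 * Real.exp (-u))) = 2 * √π / s * Real.exp (-s * √(‖p‖ ^ 2 + m ^ 2)) := by
      intro p
      rw [← hω_sq, integral_exp_neg_half_mul_sub hs (by positivity), hω_sq, neg_mul]
    simp only [Function.uncurry_apply_pair, norm_mul, Complex.norm_exp_I_mul_ofReal, one_mul,
      Complex.norm_real, Real.norm_of_nonneg (Real.exp_nonneg _), hfiber]
    exact (integrable_exp_neg_mul_sqrt_norm_sq_add hs m).const_mul _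

theorem integral_cexp_inner_mul_exp_neg_mul_sqrt {m s : ℝ} (hm : 0 < m) (hs : 0 < s) (v : V) :
    ∫ p : V, Complex.exp (Complex.I * (inner ℝ v p : ℝ)) *
      (Real.exp (-(s * √(‖p‖ ^ 2 + m ^ 2))) : ℝ) =
      (s * π ^ ((Module.finrank ℝ V - 1) / 2 : ℝ) *
        (2 * m / √(‖v‖ ^ 2 + s ^ 2)) ^ ((Module.finrank ℝ V + 1) / 2 : ℝ) : ℝ) *
        besselK ((Module.finrank ℝ V + 1) / 2) (m * √(‖v‖ ^ 2 + s ^ 2) : ℝ) := by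
  set ρ := √(‖v‖ ^ 2 + s ^ 2)
  have hρ : 0 < ρ := by positivity
  have hsub : ∀ p : V, Real.exp (-(s * √(‖p‖ ^ 2 + m ^ 2))) = s / (2 * √π) *
      ∫ u, Real.exp (-(1 / 2) * u - ((‖p‖ ^ 2 + m ^ 2) * Real.exp u +
        (s / 2) ^ 2 * Real.exp (-u))) := fun p => by
    have hω_sq : √(‖p‖ ^ 2 + m ^ 2) ^ 2 = ‖p‖ ^ 2 + m ^ 2 := Real.sq_sqrt (by positivity)
    rw [← hω_sq, integral_exp_neg_half_mul_sub hs (by positivity), hω_sq]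
    field_simp
  have hconst : ∀ d : ℝ, s / (2 * √π) * (π ^ (d / 2) * (2 * (ρ / 2 / m) ^ (-((d + 1) / 2)))) =
      s * π ^ ((d - 1) / 2) * (2 * m / ρ) ^ ((d + 1) / 2) := fun d => by
    rw [Real.rpow_neg (by positivity), ← Real.inv_rpow (by positivity), sub_div,
      Real.rpow_sub pi_pos, ← Real.sqrt_eq_rpow, div_div, inv_div]
    field_simp
  simp_rw [hsub, Complex.ofReal_mul, mul_left_comm (Complex.exp _), ← integral_complex_ofReal,
    ← integral_const_mul (Complex.exp _)]
  rw [integral_const_mul,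
    integral_integral_swap (integrable_cexp_inner_mul_exp_subordinator hm hs v)]
  simp_rw [integral_cexp_inner_mul_exp_subordinator]
  rw [integral_complex_ofReal, integral_const_mul, Complex.ofReal_mul,
    integral_exp_mul_sub_exp_add_exp hm (half_pos hρ), besselK_neg,
    show 2 * m * (ρ / 2) = m * ρ by ring]
  have hconst_cast := congrArg Complex.ofReal (hconst (Module.finrank ℝ V))
  push_cast at hconst_cast ⊢
  linear_combination besselK ((Module.finrank ℝ V + 1) / 2) (m * ρ) * hconst_cast

end FourierTransform

/-! ### The time kernel -/

theorem re_sqrt_sq (z : ℂ) : (Complex.sqrt z).re ^ 2 = (‖z‖ + z.re) / 2 := by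
  rw [Complex.sqrt, Complex.cpow_inv_two_re, Real.sq_sqrt]
  linarith [Complex.abs_re_le_norm z, neg_abs_le z.re]

theorem re_sqrt_nonneg (z : ℂ) : 0 ≤ (Complex.sqrt z).re := by
  rw [Complex.sqrt, Complex.cpow_inv_two_re]
  positivity

theorem re_sqrt_pos {z : ℂ} (hz : z ∈ Complex.slitPlane) : 0 < (Complex.sqrt z).re := by
  have hnorm : 0 < ‖z‖ + z.re := by
    rcases hz with hre | him
    · linarith [norm_nonneg z]
    · linarith [Complex.abs_re_lt_norm.2 him, neg_abs_le z.re]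
  refine (re_sqrt_nonneg z).lt_of_ne' fun h => ?_
  have hsq := re_sqrt_sq z
  rw [h] at hsq
  linarith

theorem le_re_sqrt {r : ℝ} {z : ℂ} (hz : r ^ 2 ≤ z.re) : r ≤ (Complex.sqrt z).re := by
  refine le_of_sq_le_sq ?_ (re_sqrt_nonneg z)
  linarith [re_sqrt_sq z, Complex.re_le_norm z]

theorem sq_sub_sq_mem_slitPlane {t : ℂ} (ht : t.im ≠ 0) (r : ℝ) :
    (r : ℂ) ^ 2 - t ^ 2 ∈ Complex.slitPlane := by
  have hre : ((r : ℂ) ^ 2 - t ^ 2).re = r ^ 2 - t.re ^ 2 + t.im ^ 2 := by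
    simp only [pow_two, Complex.sub_re, Complex.mul_re, Complex.ofReal_re, Complex.ofReal_im]
    ring
  have him : ((r : ℂ) ^ 2 - t ^ 2).im = -(2 * (t.re * t.im)) := by
    simp only [pow_two, Complex.sub_im, Complex.mul_im, Complex.ofReal_re, Complex.ofReal_im]
    ring
  rw [Complex.mem_slitPlane_iff, hre, him]
  rcases eq_or_ne t.re 0 with h | h
  · exact .inl (by nlinarith [sq_nonneg r, sq_pos_of_ne_zero ht])
  · exact .inr (neg_ne_zero.2 (mul_ne_zero two_ne_zero (mul_ne_zero h ht)))

/-- The function `m² K₂(m √z) / z` (principal square root), through which the time kernel depends on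
the invariant interval `z = |𝐯|² - t²`. -/
def kernelProfile (m : ℝ) (z : ℂ) : ℂ :=
  (m : ℂ) ^ 2 * besselK 2 (m * Complex.sqrt z) / z

theorem timeKernel_eq_kernelProfile (m : ℝ) (t : ℂ) (v : E3) :
    timeKernel m t v =
      Complex.I * t / (2 * (π : ℂ) ^ 2) * kernelProfile m ((‖v‖ : ℂ) ^ 2 - t ^ 2) := rfl

theorem differentiableOn_kernelProfile {m : ℝ} (hm : 0 < m) :
    DifferentiableOn ℂ (kernelProfile m) Complex.slitPlane := by
  have hsqrt : DifferentiableOn ℂ (fun z => (m : ℂ) * Complex.sqrt z) Complex.slitPlane :=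
    fun z hz => ((Complex.hasDerivAt_sqrt hz).differentiableAt.const_mul _).differentiableWithinAt
  refine (((differentiableOn_besselK 2).comp hsqrt fun z hz => ?_).const_mul _).div
    differentiableOn_id fun z hz => Complex.slitPlane_ne_zero hz
  simpa using mul_pos hm (re_sqrt_pos hz)

theorem norm_kernelProfile_le {m : ℝ} (hm : 0 < m) {r : ℝ} (hr : 1 ≤ r) {z : ℂ}
    (hz : r ^ 2 ≤ z.re) :
    ‖kernelProfile m z‖ ≤ m ^ 2 * (Real.exp (-(m * r - m)) *
      ∫ s in Set.Ioi (0 : ℝ), Real.exp (-m * Real.cosh s) * Real.cosh (2 * s)) := by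
  have hz_norm : 1 ≤ ‖z‖ := by nlinarith [Complex.re_le_norm z]
  have hre : (m * Complex.sqrt z).re = m * (Complex.sqrt z).re := Complex.re_ofReal_mul _ _
  have hle : m * r ≤ (m * Complex.sqrt z).re := by
    rw [hre]
    exact mul_le_mul_of_nonneg_left (le_re_sqrt hz) hm.le
  calc ‖kernelProfile m z‖ = m ^ 2 * ‖besselK 2 (m * Complex.sqrt z)‖ / ‖z‖ := by
        rw [kernelProfile, norm_div, norm_mul, norm_pow, Complex.norm_real,
          Real.norm_of_nonneg hm.le]
    _ ≤ m ^ 2 * ‖besselK 2 (m * Complex.sqrt z)‖ := div_le_self (by positivity) hz_norm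
    _ ≤ _ := by
        refine mul_le_mul_of_nonneg_left ((norm_besselK_le hm 2 (by nlinarith)).trans ?_)
          (sq_nonneg m)
        gcongr

theorem differentiableOn_timeKernel {m : ℝ} (hm : 0 < m) (v : E3) :
    DifferentiableOn ℂ (fun t => timeKernel m t v)
      {t | (‖v‖ : ℂ) ^ 2 - t ^ 2 ∈ Complex.slitPlane} :=
  DifferentiableOn.mul (by fun_prop)
    ((differentiableOn_kernelProfile hm).comp (by fun_prop) fun _ ht => ht)

theorem continuousOn_timeKernel {m : ℝ} (hm : 0 < m) :
    ContinuousOn (fun q : ℂ × E3 => timeKernel m q.1 q.2)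
      {q | (‖q.2‖ : ℂ) ^ 2 - q.1 ^ 2 ∈ Complex.slitPlane} :=
  ContinuousOn.mul (by fun_prop)
    ((differentiableOn_kernelProfile hm).continuousOn.comp (by fun_prop) fun _ hq => hq)

theorem continuous_timeKernel {m : ℝ} (hm : 0 < m) {t : ℂ} (ht : t.im ≠ 0) :
    Continuous (timeKernel m t) :=
  (continuousOn_timeKernel hm).comp_continuous (f := fun v => (t, v)) (by fun_prop)
    fun v => sq_sub_sq_mem_slitPlane ht ‖v‖

theorem integrable_timeKernel {m : ℝ} (hm : 0 < m) {t : ℂ} (ht : t.im ≠ 0) :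
    Integrable (timeKernel m t) := by
  refine (continuous_timeKernel hm ht).locallyIntegrable.integrable_of_isBigO_cocompact
    (g := fun v : E3 => Real.exp (-(m / 2) * ‖v‖)) (Asymptotics.IsBigO.of_bound
      (‖Complex.I * t / (2 * (π : ℂ) ^ 2)‖ * (m ^ 2 * (Real.exp m *
        ∫ s in Set.Ioi (0 : ℝ), Real.exp (-m * Real.cosh s) * Real.cosh (2 * s)))) ?_)
    ((integrable_exp_neg_mul_norm volume (half_pos hm)).integrableAtFilter _)
  filter_upwards [tendsto_norm_cocompact_atTop.eventually_ge_atTop (2 * ‖t‖),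
    tendsto_norm_cocompact_atTop.eventually_ge_atTop 2] with v hv_t hv_two
  have hinterval : (‖v‖ / 2) ^ 2 ≤ ((‖v‖ : ℂ) ^ 2 - t ^ 2).re := by
    have hre : (t ^ 2).re ≤ ‖t‖ ^ 2 := norm_pow t 2 ▸ Complex.re_le_norm _
    rw [Complex.sub_re, ← Complex.ofReal_pow, Complex.ofReal_re]
    nlinarith [norm_nonneg t]
  rw [timeKernel_eq_kernelProfile, norm_mul, mul_assoc ‖_ / _‖,
    Real.norm_of_nonneg (Real.exp_nonneg _)]
  refine (mul_le_mul_of_nonneg_left (norm_kernelProfile_le hm (by linarith) hinterval)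
    (norm_nonneg _)).trans_eq ?_
  rw [show -(m * (‖v‖ / 2) - m) = m + -(m / 2) * ‖v‖ by ring, Real.exp_add]
  ring

theorem tendstoLocallyUniformlyOn_of_continuousAt {X Y Z : Type*} [TopologicalSpace X]
    [TopologicalSpace Y] [UniformSpace Z] {F : X → Y → Z} {x₀ : X} {s : Set Y}
    (hF : ∀ y ∈ s, ContinuousAt (Function.uncurry F) (x₀, y)) :
    TendstoLocallyUniformlyOn F (F x₀) (𝓝 x₀) s := by
  refine tendstoLocallyUniformlyOn_iff_forall_tendsto.2 fun y hy => ?_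
  have hle : 𝓝 x₀ ×ˢ 𝓝[s] y ≤ 𝓝 (x₀, y) :=
    (prod_mono le_rfl nhdsWithin_le_nhds).trans nhds_prod_eq.ge
  have hslice : Tendsto (fun q : X × Y => (x₀, q.2)) (𝓝 (x₀, y)) (𝓝 (x₀, y)) :=
    (by fun_prop : Continuous fun q : X × Y => (x₀, q.2)).tendsto (x₀, y)
  have hpair := ((hF y hy).tendsto.comp hslice).prodMk_nhds (hF y hy).tendsto
  exact (hpair.mono_left hle).mono_right (nhds_le_uniformity _)

theorem tendstoLocallyUniformlyOn_timeKernel {m : ℝ} (hm : 0 < m) (τ : ℝ) :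
    TendstoLocallyUniformlyOn (timeKernel m) (timeKernel m τ) (𝓝 (τ : ℂ)) {v | |τ| < ‖v‖} := by
  refine tendstoLocallyUniformlyOn_of_continuousAt fun v hv => ?_
  refine (continuousOn_timeKernel hm).continuousAt ?_
  refine (Complex.isOpen_slitPlane.preimage (by fun_prop : Continuous fun q : ℂ × E3 =>
    (‖q.2‖ : ℂ) ^ 2 - q.1 ^ 2)).mem_nhds ?_
  have hspacelike : 0 < ‖v‖ ^ 2 - τ ^ 2 := sub_pos.2 (sq_lt_sq.2 (by rwa [abs_norm]))
  simpa using Complex.ofReal_mem_slitPlane.2 hspacelike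

section FourierInversion

variable {V : Type*} [NormedAddCommGroup V] [InnerProductSpace ℝ V] [FiniteDimensional ℝ V]
  [MeasurableSpace V] [BorelSpace V]

theorem fourierInv_eq_integral_cexp_inner (f : V → ℂ) (w : V) :
    FourierTransformInv.fourierInv f w =
      ∫ p, Complex.exp (Complex.I * (inner ℝ ((2 * π) • w) p : ℝ)) * f p := by
  rw [Real.fourierInv_eq']
  refine integral_congr_ae (ae_of_all _ fun p => ?_)
  simp only [smul_eq_mul, real_inner_smul_left, real_inner_comm w, mul_comm Complex.I]

theorem fourier_eq_integral_cexp_inner (f : V → ℂ) (p : V) :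
    FourierTransform.fourier f p =
      (((2 * π) ^ Module.finrank ℝ V)⁻¹ : ℝ) *
        ∫ v, f ((2 * π)⁻¹ • v) * Complex.exp (-(Complex.I * (inner ℝ p v : ℝ))) := by
  have hscale := Measure.integral_comp_smul volume (fun v : V => f ((2 * π)⁻¹ • v) *
    Complex.exp (-(Complex.I * (inner ℝ p v : ℝ)))) (2 * π)
  rw [abs_of_pos (by positivity), Complex.real_smul] at hscale
  rw [← hscale, Real.fourier_eq']
  refine integral_congr_ae (ae_of_all _ fun v => ?_)
  simp only [smul_eq_mul, inv_smul_smul₀ (by positivity : 2 * π ≠ 0), real_inner_smul_right,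
    real_inner_comm v, mul_comm (f v)]
  congr 2
  push_cast
  ring

theorem integral_mul_cexp_neg_inner_of_eq_integral {f K : V → ℂ} (hf : Continuous f)
    (hf_int : Integrable f) (hK_int : Integrable K)
    (hK : ∀ v, K v = (((2 * π) ^ Module.finrank ℝ V)⁻¹ : ℝ) *
      ∫ p, Complex.exp (Complex.I * (inner ℝ v p : ℝ)) * f p) (p : V) :
    ∫ v, K v * Complex.exp (-(Complex.I * (inner ℝ p v : ℝ))) = f p := by
  have htwo_pi : 2 * π ≠ 0 := by positivity
  have hinv : FourierTransformInv.fourierInv f =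
      fun w => ((2 * π) ^ Module.finrank ℝ V : ℝ) * K ((2 * π) • w) := by
    ext w
    rw [fourierInv_eq_integral_cexp_inner, hK, Complex.ofReal_inv, mul_inv_cancel_left₀]
    exact_mod_cast pow_ne_zero _ htwo_pi
  have hfourier : Integrable (FourierTransform.fourier f) := by
    have hneg : FourierTransform.fourier f = fun w => FourierTransformInv.fourierInv f (-w) := by
      ext w
      rw [Real.fourierInv_eq_fourier_neg, neg_neg]
    rw [hneg, hinv]
    exact ((hK_int.comp_smul htwo_pi).const_mul _).comp_neg
  have hinversion := congrFun (hf.fourier_fourierInv_eq hf_int hfourier) p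
  rw [fourier_eq_integral_cexp_inner, hinv, ← integral_const_mul] at hinversion
  rw [← hinversion]
  refine integral_congr_ae (ae_of_all _ fun v => ?_)
  simp only [smul_inv_smul₀ htwo_pi, Complex.ofReal_inv]
  rw [← mul_assoc, inv_mul_cancel_left₀]
  exact_mod_cast pow_ne_zero _ htwo_pi

end FourierInversion

theorem omega_pos {m : ℝ} (hm : 0 < m) (p : E3) : 0 < omega m p := by
  unfold omega
  positivity

theorem timeKernel_neg_I_mul {m : ℝ} (hm : 0 < m) {s : ℝ} (hs : 0 < s) (v : E3) :
    timeKernel m (-Complex.I * s) v = (((2 * π) ^ 3)⁻¹ : ℝ) *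
      ∫ p : E3, Complex.exp (Complex.I * (inner ℝ v p : ℝ)) *
        (Real.exp (-(s * omega m p)) : ℝ) := by
  have hinterval : (‖v‖ : ℂ) ^ 2 - (-Complex.I * s) ^ 2 = (‖v‖ ^ 2 + s ^ 2 : ℝ) := by
    rw [mul_pow, neg_sq, Complex.I_sq]
    push_cast
    ring
  have hsqrt : Complex.sqrt (‖v‖ ^ 2 + s ^ 2 : ℝ) = (√(‖v‖ ^ 2 + s ^ 2) : ℝ) := by
    rw [Complex.sqrt_of_nonneg (by exact_mod_cast (by positivity : 0 ≤ ‖v‖ ^ 2 + s ^ 2)),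
      Complex.ofReal_re]
  have htransform := integral_cexp_inner_mul_exp_neg_mul_sqrt hm hs v
  rw [finrank_euclideanSpace_fin, Nat.cast_ofNat, show ((3 : ℝ) - 1) / 2 = 1 by norm_num,
    show ((3 : ℝ) + 1) / 2 = 2 by norm_num, Real.rpow_one, Real.rpow_two] at htransform
  simp only [omega]
  rw [htransform, timeKernel_eq_kernelProfile, kernelProfile, hinterval, hsqrt,
    ← Complex.ofReal_mul, show Complex.I * (-Complex.I * s) = s by
      rw [← mul_assoc, mul_neg, Complex.I_mul_I, neg_neg, one_mul], div_pow,
    Real.sq_sqrt (by positivity)]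
  have hρ : (‖v‖ : ℂ) ^ 2 + s ^ 2 ≠ 0 := by
    exact_mod_cast (by positivity : ‖v‖ ^ 2 + s ^ 2 ≠ 0)
  push_cast
  field_simp

theorem continuous_cexp_neg_I_mul_omega (m : ℝ) (t : ℂ) :
    Continuous fun p => Complex.exp (-(Complex.I * t) * omega m p) := by
  have := continuous_omega m
  fun_prop

theorem norm_cexp_neg_I_mul_omega (m : ℝ) (t : ℂ) (p : E3) :
    ‖Complex.exp (-(Complex.I * t) * omega m p)‖ = Real.exp (t.im * omega m p) := by
  simp [Complex.norm_exp]

theorem integrable_cexp_neg_I_mul_omega (m : ℝ) {t : ℂ} (ht : t.im < 0) :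
    Integrable fun p => Complex.exp (-(Complex.I * t) * omega m p) := by
  refine (integrable_exp_neg_mul_sqrt_norm_sq_add (neg_pos.2 ht) m).mono'
    (continuous_cexp_neg_I_mul_omega m t).aestronglyMeasurable (ae_of_all _ fun p => ?_)
  rw [norm_cexp_neg_I_mul_omega, neg_neg, omega]

theorem differentiableOn_integral_cexp_neg_I_mul_omega (m : ℝ) (v : E3) :
    DifferentiableOn ℂ (fun t : ℂ => ∫ p : E3, Complex.exp (-(Complex.I * t) * omega m p) •
      Complex.exp (Complex.I * (inner ℝ v p : ℝ))) {t | t.im < 0} := by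
  refine (differentiableOn_integral_cexp_neg_mul_smul (μ := volume) (a := omega m)
    (b := fun p => Complex.exp (Complex.I * (inner ℝ v p : ℝ))) (continuous_omega m).measurable
    (fun p => Real.sqrt_nonneg _) (by fun_prop) fun δ hδ => ?_).comp
    (f := fun t => Complex.I * t) (by fun_prop) fun t ht => by simpa using ht
  simp only [Complex.norm_exp_I_mul_ofReal, mul_one]
  exact integrable_exp_neg_mul_sqrt_norm_sq_add hδ m

theorem timeKernel_eq_integral {m : ℝ} (hm : 0 < m) {t : ℂ} (ht : t.im < 0) (v : E3) :
    timeKernel m t v = (((2 * π) ^ 3)⁻¹ : ℝ) *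
      ∫ p : E3, Complex.exp (Complex.I * (inner ℝ v p : ℝ)) *
        Complex.exp (-(Complex.I * t) * omega m p) := by
  simp_rw [mul_comm (Complex.exp (Complex.I * _))]
  have hopen : IsOpen {t : ℂ | t.im < 0} := isOpen_lt Complex.continuous_im continuous_const
  have hleft : AnalyticOnNhd ℂ (fun t => timeKernel m t v) {t | t.im < 0} :=
    ((differentiableOn_timeKernel hm v).mono fun t ht =>
      sq_sub_sq_mem_slitPlane (ne_of_lt ht) _).analyticOnNhd hopen
  have hright := ((differentiableOn_integral_cexp_neg_I_mul_omega m v).const_mul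
    (((2 * π) ^ 3)⁻¹ : ℝ)).analyticOnNhd hopen
  refine hleft.eqOn_of_preconnected_of_frequently_eq hright
    (convex_halfSpace_im_lt 0).isPreconnected (z₀ := -Complex.I * (1 : ℝ)) (by simp) ?_ ht
  have haxis : HasDerivAt (fun s : ℝ => -Complex.I * (s : ℂ)) (-Complex.I) 1 := by
    simpa using (Complex.ofRealCLM.hasDerivAt (x := 1)).const_mul (-Complex.I)
  refine (haxis.tendsto_nhdsNE (neg_ne_zero.2 Complex.I_ne_zero)).frequently
    (Eventually.frequently ?_)
  filter_upwards [nhdsWithin_le_nhds (lt_mem_nhds one_pos)] with s hs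
  rw [timeKernel_neg_I_mul hm hs]
  congr 2
  ext p
  rw [smul_eq_mul, mul_comm, Complex.ofReal_exp, ← mul_assoc, mul_neg, Complex.I_mul_I]
  push_cast
  ring_nf

theorem integral_timeKernel_mul_cexp_neg_inner {m : ℝ} (hm : 0 < m) {t : ℂ} (ht : t.im < 0)
    (p : E3) :
    ∫ v : E3, timeKernel m t v * Complex.exp (-(Complex.I * (inner ℝ p v : ℝ))) =
      Complex.exp (-(Complex.I * t) * omega m p) := by
  refine integral_mul_cexp_neg_inner_of_eq_integral (continuous_cexp_neg_I_mul_omega m t)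
    (integrable_cexp_neg_I_mul_omega m ht) (integrable_timeKernel hm ht.ne) (fun v => ?_) p
  rw [finrank_euclideanSpace_fin]
  exact timeKernel_eq_integral hm ht v

/-! ### Annihilation operators on the Schwartz core -/

theorem le_omega (m : ℝ) (p : E3) : m ≤ omega m p :=
  Real.le_sqrt_of_sq_le (le_add_of_nonneg_left (by positivity))

theorem norm_le_omega (m : ℝ) (p : E3) : ‖p‖ ≤ omega m p :=
  Real.le_sqrt_of_sq_le (le_add_of_nonneg_right (by positivity))

theorem omega_le {m : ℝ} (hm : 0 ≤ m) (p : E3) : omega m p ≤ m + ‖p‖ :=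
  Real.sqrt_le_iff.2 ⟨by positivity, by nlinarith [mul_nonneg hm (norm_nonneg p)]⟩

theorem integrable_shellMeasure_of_integrable {F : Type*} [NormedAddCommGroup F] {m : ℝ}
    (hm : 0 < m) {f : E3 → F} (hf : Integrable f) : Integrable f (shellMeasure m) := by
  refine hf.of_measure_le_smul (c := ENNReal.ofReal (1 / (2 * m))) ENNReal.ofReal_ne_top ?_
  rw [shellMeasure, ← withDensity_const]
  refine withDensity_mono (ae_of_all _ fun p => ENNReal.ofReal_le_ofReal ?_)
  have := le_omega m p
  gcongr

theorem integrable_shellMeasure_inv_one_add_norm_pow {m : ℝ} (hm : 0 < m) {n : ℕ} (hn : 3 < n) :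
    Integrable (fun p => ((1 + ‖p‖) ^ n)⁻¹) (shellMeasure m) := by
  have hfinrank : (Module.finrank ℝ E3 : ℝ) < n := by
    rw [finrank_euclideanSpace_fin]
    exact_mod_cast hn
  refine integrable_shellMeasure_of_integrable hm
    ((integrable_one_add_norm (μ := volume) hfinrank).congr (ae_of_all _ fun p => ?_))
  simp only [Real.rpow_neg (add_nonneg zero_le_one (norm_nonneg p)), Real.rpow_natCast]

theorem memLp_two_prod_inv_one_add_norm_pow {m : ℝ} (hm : 0 < m) {n : ℕ} (hn : 3 < n) (k : ℕ) :
    MemLp (fun q : Fin k → E3 => ∏ j, ((1 + ‖q j‖) ^ n)⁻¹) 2 (shellMeasurePi m k) := by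
  have hcont : Continuous fun q : Fin k → E3 => ∏ j, ((1 + ‖q j‖) ^ n)⁻¹ :=
    continuous_finsetProd _ fun j _ => Continuous.inv₀ (by fun_prop) fun q => by positivity
  rw [memLp_two_iff_integrable_sq hcont.aestronglyMeasurable]
  simp only [← Finset.prod_pow, inv_pow, ← pow_mul]
  exact Integrable.fintype_prod (f := fun (_ : Fin k) (p : E3) => ((1 + ‖p‖) ^ (n * 2))⁻¹)
    fun _ => integrable_shellMeasure_inv_one_add_norm_pow hm (by omega)

theorem exists_norm_schwartz_le_prod {ι E F : Type*} [Fintype ι] [NormedAddCommGroup E]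
    [NormedSpace ℝ E] [NormedAddCommGroup F] [NormedSpace ℝ F] (g : SchwartzMap (ι → E) F)
    (n : ℕ) : ∃ A : ℝ, ∀ p, ‖g p‖ ≤ A * ∏ j, ((1 + ‖p j‖) ^ n)⁻¹ := by
  set N := n * Fintype.card ι
  refine ⟨2 ^ N * (Finset.Iic (N, 0)).sup (fun i => SchwartzMap.seminorm ℝ i.1 i.2) g,
    fun p => ?_⟩
  have hdecay := SchwartzMap.one_add_le_sup_seminorm_apply (𝕜 := ℝ) (m := (N, 0)) le_rfl le_rfl g p
  rw [norm_iteratedFDeriv_zero] at hdecay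
  have hprod : ∏ j, (1 + ‖p j‖) ^ n ≤ (1 + ‖p‖) ^ N :=
    calc ∏ j, (1 + ‖p j‖) ^ n ≤ ∏ _j : ι, (1 + ‖p‖) ^ n :=
          Finset.prod_le_prod (fun j _ => by positivity) fun j _ => by
            gcongr
            exact norm_le_pi_norm p j
      _ = (1 + ‖p‖) ^ N := by rw [Finset.prod_const, Finset.card_univ, pow_mul]
  have hpos : 0 < ∏ j, (1 + ‖p j‖) ^ n := Finset.prod_pos fun j _ => by positivity
  rw [Finset.prod_inv_distrib, ← div_eq_mul_inv, le_div_iff₀ hpos, mul_comm]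
  exact (mul_le_mul_of_nonneg_right hprod (norm_nonneg _)).trans hdecay

theorem exists_norm_mul_schwartz_cons_le {E : Type*} [NormedAddCommGroup E] [NormedSpace ℝ E]
    {u : E → ℂ} {C : ℝ} {n : ℕ} (hu : ∀ p, ‖u p‖ ≤ C * (1 + ‖p‖) ^ n) {k : ℕ}
    (g : SchwartzMap (Fin (k + 1) → E) ℂ) (r : ℕ) :
    ∃ A : ℝ, ∀ (q : Fin k → E) (p : E), ‖u p * g (Fin.cons p q)‖ ≤
      (A * ∏ j, ((1 + ‖q j‖) ^ r)⁻¹) * ((1 + ‖p‖) ^ r)⁻¹ := by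
  obtain ⟨A, hA⟩ := exists_norm_schwartz_le_prod g (n + r)
  have hA0 : 0 ≤ A := by simpa using (norm_nonneg _).trans (hA 0)
  have hC0 : 0 ≤ C := by simpa using (norm_nonneg _).trans (hu 0)
  refine ⟨C * A, fun q p => ?_⟩
  have hg := hA (Fin.cons p q)
  rw [Fin.prod_univ_succ] at hg
  simp only [Fin.cons_zero, Fin.cons_succ] at hg
  have hprod : ∏ j, ((1 + ‖q j‖) ^ (n + r))⁻¹ ≤ ∏ j, ((1 + ‖q j‖) ^ r)⁻¹ :=
    Finset.prod_le_prod (fun j _ => by positivity) fun j _ => by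
      gcongr
      · linarith [norm_nonneg (q j)]
      · omega
  calc ‖u p * g (Fin.cons p q)‖ = ‖u p‖ * ‖g (Fin.cons p q)‖ := norm_mul _ _
    _ ≤ C * (1 + ‖p‖) ^ n * (A * (((1 + ‖p‖) ^ (n + r))⁻¹ * ∏ j, ((1 + ‖q j‖) ^ r)⁻¹)) := by
        gcongr
        · exact hu p
        · exact hg.trans (by gcongr)
    _ = C * A * (∏ j, ((1 + ‖q j‖) ^ r)⁻¹) * ((1 + ‖p‖) ^ r)⁻¹ := by
        have : 0 < 1 + ‖p‖ := by positivity
        rw [pow_add]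
        field_simp

section DominatedKernel

variable {α X : Type*} [TopologicalSpace X] [MeasurableSpace X] {μ : Measure X}
  {F : α → X → ℂ} {B : α → ℝ} {b : X → ℝ}

theorem norm_integral_mul_le_of_dominated (hb : Integrable b μ)
    (hFb : ∀ q x, ‖F q x‖ ≤ B q * b x) (f : BoundedContinuousFunction X ℂ) (q : α) :
    ‖∫ x, f x * F q x ∂μ‖ ≤ (∫ x, b x ∂μ) * ‖f‖ * B q := by
  calc ‖∫ x, f x * F q x ∂μ‖ ≤ ∫ x, ‖f‖ * B q * b x ∂μ := by
        refine norm_integral_le_of_norm_le (hb.const_mul _) (ae_of_all _ fun x => ?_)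
        rw [norm_mul, mul_assoc]
        exact mul_le_mul (f.norm_coe_le_norm x) (hFb q x) (norm_nonneg _) (norm_nonneg _)
    _ = (∫ x, b x ∂μ) * ‖f‖ * B q := by rw [integral_const_mul]; ring

variable [MeasurableSpace α] {ν : Measure α} [OpensMeasurableSpace X]

theorem integrable_mul_of_dominated (hF : StronglyMeasurable (Function.uncurry F))
    (hb : Integrable b μ) (hFb : ∀ q x, ‖F q x‖ ≤ B q * b x)
    (f : BoundedContinuousFunction X ℂ) (q : α) : Integrable (fun x => f x * F q x) μ :=
  ((hb.const_mul (B q)).mono' (hF.comp_measurable measurable_prodMk_left).aestronglyMeasurable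
    (ae_of_all _ (hFb q))).bdd_mul f.continuous.stronglyMeasurable.aestronglyMeasurable
    (ae_of_all _ f.norm_coe_le_norm)

theorem exists_clm_ae_eq_integral_mul [SFinite μ] {p : ENNReal} [Fact (1 ≤ p)]
    (hF : StronglyMeasurable (Function.uncurry F)) (hB : MemLp B p ν) (hb : Integrable b μ)
    (hFb : ∀ q x, ‖F q x‖ ≤ B q * b x) :
    ∃ T : BoundedContinuousFunction X ℂ →L[ℂ] Lp ℂ p ν,
      ∀ f, T f =ᵐ[ν] fun q => ∫ x, f x * F q x ∂μ := by
  have hint := integrable_mul_of_dominated hF hb hFb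
  have hbound (f : BoundedContinuousFunction X ℂ) (q : α) :
      ‖∫ x, f x * F q x ∂μ‖ ≤ ‖∫ x, b x ∂μ‖ * ‖f‖ * ‖B q‖ := by
    refine (norm_integral_mul_le_of_dominated hb hFb f q).trans ((Real.le_norm_self _).trans ?_)
    rw [norm_mul, norm_mul, norm_norm]
  have hmemLp (f : BoundedContinuousFunction X ℂ) : MemLp (fun q => ∫ x, f x * F q x ∂μ) p ν :=
    hB.of_le_mul ((f.continuous.stronglyMeasurable.comp_measurable
      measurable_snd).mul hF).integral_prod_right.aestronglyMeasurable (ae_of_all _ (hbound f))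
  let T : BoundedContinuousFunction X ℂ →ₗ[ℂ] Lp ℂ p ν :=
    { toFun := fun f => (hmemLp f).toLp
      map_add' := fun f₁ f₂ => by
        rw [← MemLp.toLp_add]
        refine MemLp.toLp_congr _ _ (ae_of_all _ fun q => ?_)
        simp only [BoundedContinuousFunction.add_apply, add_mul, Pi.add_apply]
        exact integral_add (hint f₁ q) (hint f₂ q)
      map_smul' := fun a f => by
        rw [RingHom.id_apply, ← MemLp.toLp_const_smul]
        refine MemLp.toLp_congr _ _ (ae_of_all _ fun q => ?_)
        simp only [BoundedContinuousFunction.smul_apply, smul_eq_mul, mul_assoc, Pi.smul_apply]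
        exact integral_const_mul a _ }
  refine ⟨T.mkContinuous (‖∫ x, b x ∂μ‖ * ‖hB.toLp‖) fun f => ?_, fun f => (hmemLp f).coeFn_toLp⟩
  rw [mul_right_comm]
  refine Lp.norm_le_mul_norm_of_ae_le_mul ?_
  filter_upwards [(hmemLp f).coeFn_toLp, hB.coeFn_toLp] with q hTf hBq
  rw [hBq]
  exact (congrArg norm hTf).trans_le (hbound f q)

end DominatedKernel

theorem finCons_comp_decomposeFin_symm {α : Type*} {k : ℕ} (σ : Equiv.Perm (Fin k)) (p : α)
    (q : Fin k → α) :
    (Fin.cons p q : Fin (k + 1) → α) ∘ Equiv.Perm.decomposeFin.symm (0, σ) =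
      Fin.cons p (q ∘ σ) := by
  ext i
  refine Fin.cases ?_ (fun j => ?_) i <;> simp

/-- At the momenta `q`, the function `φ` takes the value `√(k+1) ∫ c(𝐩) ψ(𝐩, q)` of the contraction
of `ψ` with `c` in the first momentum, the integral being absolutely convergent. -/
def IsContractionAt (m : ℝ) (c : E3 → ℂ) {k : ℕ} (ψ : (Fin (k + 1) → E3) → ℂ)
    (φ : (Fin k → E3) → ℂ) (q : Fin k → E3) : Prop :=
  Integrable (fun p => c p * ψ (Fin.cons p q)) (shellMeasure m) ∧
  φ q = (√((k : ℝ) + 1) : ℂ) * ∫ p, c p * ψ (Fin.cons p q) ∂(shellMeasure m)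

/-- Almost everywhere, `φ` is the contraction of `ψ` with `c`: the `k`-particle condition in the
definition of `annihilationGraph`. -/
def IsContraction (m : ℝ) (c : E3 → ℂ) {k : ℕ} (ψ : (Fin (k + 1) → E3) → ℂ)
    (φ : (Fin k → E3) → ℂ) : Prop :=
  ∀ᵐ q ∂(shellMeasurePi m k), IsContractionAt m c ψ φ q

theorem mem_annihilationGraph_iff {m : ℝ} {c : E3 → ℂ} {X : Fock m × Fock m} :
    X ∈ annihilationGraph m c ↔
      ∀ k, IsContraction m c (X.1.wave (k + 1)) (X.2.wave k) :=
  Iff.rfl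

section IsContraction

variable {m : ℝ} {c : E3 → ℂ} {k : ℕ} {ψ ψ' : (Fin (k + 1) → E3) → ℂ}
  {φ φ' : (Fin k → E3) → ℂ}

theorem isContraction_congr (hψ : ψ =ᵐ[shellMeasurePi m (k + 1)] ψ')
    (hφ : φ =ᵐ[shellMeasurePi m k] φ') : IsContraction m c ψ φ ↔ IsContraction m c ψ' φ' := by
  refine eventually_congr ?_
  filter_upwards [hφ, ae_ae_cons m hψ] with q hq hcons
  have hint : (fun p => c p * ψ (Fin.cons p q)) =ᵐ[shellMeasure m]
      fun p => c p * ψ' (Fin.cons p q) := by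
    filter_upwards [hcons] with p hp
    rw [hp]
  rw [IsContractionAt, IsContractionAt, hq, integrable_congr hint, integral_congr_ae hint]

theorem isContraction_zero : IsContraction m c (0 : (Fin (k + 1) → E3) → ℂ) 0 :=
  ae_of_all _ fun q => by simp [IsContractionAt]

theorem IsContraction.ae_eq (hφ : IsContraction m c ψ φ) (hφ' : IsContraction m c ψ φ') :
    φ =ᵐ[shellMeasurePi m k] φ' := by
  filter_upwards [hφ, hφ'] with q hq hq'
  rw [hq.2, hq'.2]

theorem IsContraction.comp_perm (h : IsContraction m c ψ φ) (σ : Equiv.Perm (Fin k)) :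
    IsContraction m c (fun p => ψ (p ∘ Equiv.Perm.decomposeFin.symm (0, σ)))
      (fun q => φ (q ∘ σ)) := by
  filter_upwards [(measurePreserving_perm m σ).quasiMeasurePreserving.ae h] with q hq
  simpa only [IsContractionAt, finCons_comp_decomposeFin_symm] using hq

theorem IsContraction.mem_symmSpace {ψ : symmSpace m (k + 1)} {φ : Lp ℂ 2 (shellMeasurePi m k)}
    (h : IsContraction m c (ψ : Lp ℂ 2 (shellMeasurePi m (k + 1))) φ) : φ ∈ symmSpace m k :=
  fun σ => ((isContraction_congr (ψ.2 _) EventuallyEq.rfl).1 (h.comp_perm σ)).ae_eq h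

theorem phase_cons (y : SpaceTime) (p : E3) (q : Fin k → E3) :
    phase m y (Fin.cons p q : Fin (k + 1) → E3) =
      Complex.exp (Complex.I * (shellDot m p y : ℝ)) * phase m y q := by
  simp [phase, Fin.sum_univ_succ, ← Complex.exp_add, mul_add]

theorem phase_ne_zero (y : SpaceTime) (p : Fin k → E3) : phase m y p ≠ 0 :=
  Complex.exp_ne_zero _

theorem isContractionAt_phase_mul_comp (e : E3 ≃ₗᵢ[ℝ] E3) (y : SpaceTime) {c' : E3 → ℂ}
    (hc : ∀ p, c' p * Complex.exp (Complex.I * (shellDot m p y : ℝ)) = c (e.symm p))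
    (q : Fin k → E3) :
    IsContractionAt m c' (fun p => phase m y p * ψ (fun j => e.symm (p j)))
        (fun q => phase m y q * φ (fun j => e.symm (q j))) q ↔
      IsContractionAt m c ψ φ (fun j => e.symm (q j)) := by
  have hmp := measurePreserving_isometry m e.symm
  have hemb : MeasurableEmbedding e.symm := e.symm.toHomeomorph.measurableEmbedding
  have hintegrand (p : E3) : c' p * (phase m y (Fin.cons p q : Fin (k + 1) → E3) *
      ψ (fun j => e.symm ((Fin.cons p q : Fin (k + 1) → E3) j))) =
      phase m y q * (c (e.symm p) * ψ (Fin.cons (e.symm p) fun j => e.symm (q j))) := by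
    rw [phase_cons, ← hc, ← Function.comp_def e.symm (Fin.cons p q), Fin.comp_cons]
    simp only [Function.comp_def]
    ring
  simp only [IsContractionAt, hintegrand]
  rw [integrable_const_mul_iff (IsUnit.mk0 _ (phase_ne_zero y q)), integral_const_mul,
    mul_left_comm, mul_right_inj' (phase_ne_zero y q)]
  exact and_congr (hmp.integrable_comp_emb hemb (g := fun p => c p * ψ (Fin.cons p _)))
    (by rw [← hmp.integral_comp hemb fun p => c p * ψ (Fin.cons p _)])

theorem isContraction_phase_mul_comp (e : E3 ≃ₗᵢ[ℝ] E3) (y : SpaceTime) {c' : E3 → ℂ}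
    (hc : ∀ p, c' p * Complex.exp (Complex.I * (shellDot m p y : ℝ)) = c (e.symm p)) :
    IsContraction m c' (fun p => phase m y p * ψ (fun j => e.symm (p j)))
        (fun q => phase m y q * φ (fun j => e.symm (q j))) ↔
      IsContraction m c ψ φ := by
  simp only [IsContraction, isContractionAt_phase_mul_comp e y hc]
  refine ⟨fun h => ?_, (measurePreserving_rotPi m e.symm k).quasiMeasurePreserving.ae⟩
  simpa only [e.symm_apply_apply] using
    (measurePreserving_rotPi m e k).quasiMeasurePreserving.ae h

theorem exists_clm_isContraction (hm : 0 < m) {u : E3 → ℂ} (hu : Continuous u) {C : ℝ} {n : ℕ}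
    (hC : ∀ p, ‖u p‖ ≤ C * (1 + ‖p‖) ^ n) (g : SchwartzMap (Fin (k + 1) → E3) ℂ) :
    ∃ T : BoundedContinuousFunction E3 ℂ →L[ℂ] Lp ℂ 2 (shellMeasurePi m k),
      ∀ f, IsContraction m (fun p => f p * u p) g (T f) := by
  obtain ⟨A, hA⟩ := exists_norm_mul_schwartz_cons_le hC g 4
  have hcont : Continuous (Function.uncurry fun (q : Fin k → E3) p => u p * g (Fin.cons p q)) :=
    (hu.comp continuous_snd).mul
      (g.continuous.comp (Continuous.finCons (A := fun _ => E3) continuous_snd continuous_fst))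
  have hq := (memLp_two_prod_inv_one_add_norm_pow hm (n := 4) (by norm_num) k).const_mul A
  have hp := integrable_shellMeasure_inv_one_add_norm_pow hm (n := 4) (by norm_num)
  obtain ⟨T, hT⟩ := exists_clm_ae_eq_integral_mul hcont.stronglyMeasurable hq hp hA
  refine ⟨(√((k : ℝ) + 1) : ℂ) • T, fun f => ?_⟩
  filter_upwards [hT f, Lp.coeFn_smul (√((k : ℝ) + 1) : ℂ) (T f)] with q hTq hsmul
  simp only [IsContractionAt, mul_assoc]
  refine ⟨integrable_mul_of_dominated hcont.stronglyMeasurable hp hA f q, ?_⟩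
  rw [_root_.smul_apply, hsmul, Pi.smul_apply, smul_eq_mul, hTq]

theorem exists_clm_symmSpace_isContraction (hm : 0 < m) {u : E3 → ℂ} (hu : Continuous u) {C : ℝ}
    {n : ℕ} (hC : ∀ p, ‖u p‖ ≤ C * (1 + ‖p‖) ^ n) (ψ : symmSpace m (k + 1))
    {g : SchwartzMap (Fin (k + 1) → E3) ℂ}
    (hg : (ψ : Lp ℂ 2 (shellMeasurePi m (k + 1))) =ᵐ[shellMeasurePi m (k + 1)] g) :
    ∃ T : BoundedContinuousFunction E3 ℂ →L[ℂ] symmSpace m k,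
      ∀ f, IsContraction m (fun p => f p * u p) (ψ : Lp ℂ 2 (shellMeasurePi m (k + 1)))
        (T f : Lp ℂ 2 (shellMeasurePi m k)) := by
  obtain ⟨T, hT⟩ := exists_clm_isContraction hm hu hC g
  have hψ (f : BoundedContinuousFunction E3 ℂ) := (isContraction_congr hg EventuallyEq.rfl).2 (hT f)
  exact ⟨T.codRestrict (symmSpace m k) fun f => (hψ f).mem_symmSpace, hψ⟩

end IsContraction

theorem exists_clm_mem_annihilationGraph {m : ℝ} (hm : 0 < m) {u : E3 → ℂ} (hu : Continuous u)
    {C : ℝ} {n : ℕ} (hC : ∀ p, ‖u p‖ ≤ C * (1 + ‖p‖) ^ n) {Ψ : Fock m}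
    (hΨ : Ψ ∈ schwartzCore m) :
    ∃ T : BoundedContinuousFunction E3 ℂ →L[ℂ] Fock m,
      ∀ f, (Ψ, T f) ∈ annihilationGraph m (fun p => f p * u p) := by
  obtain ⟨⟨N, hN⟩, hSchwartz⟩ := hΨ
  choose g hg using hSchwartz
  choose T hT using fun k => exists_clm_symmSpace_isContraction hm hu hC (Ψ (k + 1)) (hg (k + 1))
  let S := ∑ k ∈ Finset.range N,
    (lp.singleContinuousLinearMap ℂ (fun k : ℕ => symmSpace m k) 2 k) ∘L T k
  have hS (f : BoundedContinuousFunction E3 ℂ) (k : ℕ) : S f k = if k < N then T k f else 0 := by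
    simp only [S]
    rw [_root_.sum_apply]
    simp only [ContinuousLinearMap.comp_apply, lp.singleContinuousLinearMap_apply, lp.coeFn_sum,
      Finset.sum_apply, lp.coeFn_single, Finset.sum_pi_single, Finset.mem_range]
  refine ⟨S, fun f => mem_annihilationGraph_iff.2 fun k => ?_⟩
  rw [Fock.wave, Fock.wave, hS]
  split_ifs with hk
  · exact hT k f
  · rw [hN (k + 1) (by omega)]
    exact (isContraction_congr (Fock.wave_zero m (k + 1)) (Fock.wave_zero m k)).2
      isContraction_zero

/-! ### Poincaré covariance -/

/-- The operator `U(y, Λ)` for an arbitrary orthogonal map `e` of `ℝ³` in place of a rotation. -/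
def fockUnitary (m : ℝ) (y : SpaceTime) (e : E3 ≃ₗᵢ[ℝ] E3) : Fock m ≃ₗᵢ[ℂ] Fock m :=
  LinearIsometryEquiv.ofSurjective (fockIsometry m y e) (fockIsometry_surjective m y e)

theorem wave_fockUnitary {m : ℝ} (y : SpaceTime) (e : E3 ≃ₗᵢ[ℝ] E3) (Ψ : Fock m) (k : ℕ) :
    (fockUnitary m y e Ψ).wave k =ᵐ[shellMeasurePi m k]
      fun p => phase m y p * Ψ.wave k (fun j => e.symm (p j)) :=
  coeFn_act m y e k (Ψ k)

theorem fockUnitary_mem_annihilationGraph_iff {m : ℝ} (y : SpaceTime) (e : E3 ≃ₗᵢ[ℝ] E3)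
    {c c' : E3 → ℂ}
    (hc : ∀ p, c' p * Complex.exp (Complex.I * (shellDot m p y : ℝ)) = c (e.symm p))
    (Ψ Φ : Fock m) :
    (fockUnitary m y e Ψ, fockUnitary m y e Φ) ∈ annihilationGraph m c' ↔
      (Ψ, Φ) ∈ annihilationGraph m c := by
  simp only [mem_annihilationGraph_iff]
  exact forall_congr' fun k =>
    (isContraction_congr (wave_fockUnitary y e Ψ (k + 1)) (wave_fockUnitary y e Φ k)).trans
      (isContraction_phase_mul_comp e y hc)

theorem mem_graph_conjugate_iff {m : ℝ} (V : Fock m ≃ₗᵢ[ℂ] Fock m) (A : Fock m →ₗ.[ℂ] Fock m)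
    {Ψ Φ : Fock m} : (Ψ, Φ) ∈ (conjugate V A).graph ↔ (V.symm Ψ, V.symm Φ) ∈ A.graph := by
  simp only [LinearPMap.mem_graph_iff]
  constructor
  · rintro ⟨χ, rfl, rfl⟩
    exact ⟨⟨V.symm χ, χ.2⟩, rfl, by rw [conjugate_apply, V.symm_apply_apply]⟩
  · rintro ⟨χ, hχ, hΦ⟩
    have hΨ : V.symm Ψ ∈ A.domain := hχ ▸ χ.2
    refine ⟨⟨Ψ, hΨ⟩, rfl, ?_⟩
    rw [conjugate_apply, show (⟨V.symm Ψ, hΨ⟩ : A.domain) = χ from Subtype.ext hχ.symm, hΦ,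
      V.apply_symm_apply]

theorem conj_localizedWave (m : ℝ) (x : SpaceTime) (p : E3) :
    (starRingEnd ℂ) (localizedWave m x p) = (((2 * π) ^ (-(3 / 2) : ℝ) : ℝ) : ℂ) *
      Complex.exp (-(Complex.I * (shellDot m p x : ℝ))) * (√(2 * omega m p) : ℝ) := by
  rw [localizedWave, map_mul, map_mul, ← Complex.exp_conj, map_mul, Complex.conj_ofReal,
    Complex.conj_ofReal, Complex.conj_I, Complex.conj_ofReal, neg_mul]

theorem shellDot_poincare (m : ℝ) (e : E3 ≃ₗᵢ[ℝ] E3) (x y : SpaceTime) (p : E3) :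
    shellDot m p (x.1 + y.1, e x.2 + y.2) = shellDot m (e.symm p) x + shellDot m p y := by
  have hinner : inner ℝ p (e x.2) = inner ℝ (e.symm p) x.2 := by
    rw [← e.inner_map_map (e.symm p), e.apply_symm_apply]
  simp only [shellDot, omega_isometry, inner_add_right, hinner]
  ring

theorem conjugate_phi1 (m : ℝ) (y : SpaceTime) (e : E3 ≃ₗᵢ[ℝ] E3) (x : SpaceTime) :
    conjugate (fockUnitary m y e) (phi1 m x) = phi1 m (x.1 + y.1, e x.2 + y.2) := by
  refine LinearPMap.eq_of_eq_graph (Submodule.ext fun ⟨Ψ, Φ⟩ => ?_)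
  have hcov := fockUnitary_mem_annihilationGraph_iff y e
    (c := fun p => (starRingEnd ℂ) (localizedWave m x p))
    (c' := fun p => (starRingEnd ℂ) (localizedWave m (x.1 + y.1, e x.2 + y.2) p)) (fun p => ?_)
    ((fockUnitary m y e).symm Ψ) ((fockUnitary m y e).symm Φ)
  · rw [mem_graph_conjugate_iff, phi1, phi1, annihilation_graph, annihilation_graph, ← hcov]
    simp only [LinearIsometryEquiv.apply_symm_apply]
  · rw [conj_localizedWave, conj_localizedWave, omega_isometry, shellDot_poincare, mul_right_comm,
      mul_assoc (_ : ℂ) (Complex.exp _) (Complex.exp _), ← Complex.exp_add]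
    congr 3
    push_cast
    ring

theorem aTilde_eq_phi1 {m : ℝ} (hm : 0 < m) (x : E3) : aTilde m x = phi1 m (0, x) := by
  rw [aTilde, phi1, annihilationNC]
  congr 1
  ext p
  have hω : 0 < 2 * omega m p := mul_pos two_pos (omega_pos hm p)
  have hsqrt : ((√(2 * omega m p) : ℝ) : ℂ) ≠ 0 :=
    Complex.ofReal_ne_zero.2 (Real.sqrt_pos.2 hω).ne'
  have hsq : ((2 * omega m p : ℝ) : ℂ) = (√(2 * omega m p) : ℝ) * (√(2 * omega m p) : ℝ) := by
    rw [← Complex.ofReal_mul, Real.mul_self_sqrt hω.le]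
  have hdot : -(Complex.I * (shellDot m p (0, x) : ℝ)) = Complex.I * (inner ℝ p x : ℝ) := by
    simp [shellDot]
  rw [conj_localizedWave, hsq, hdot]
  field_simp

/-! ### Plane waves -/

theorem norm_cexp_sub_cexp_le {z w : ℂ} (hz : z.re ≤ 0) (hw : w.re ≤ 0) :
    ‖Complex.exp z - Complex.exp w‖ ≤ ‖z - w‖ := by
  simpa using (convex_halfSpace_re_le 0).norm_image_sub_le_of_norm_deriv_le (C := 1)
    (fun u _ => Complex.differentiableAt_exp)
    (fun u (hu : u.re ≤ 0) => by simpa [Complex.norm_exp] using hu) hw hz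

theorem re_I_mul_sub_mul_omega (m : ℝ) (t : ℂ) (a : ℝ) (p : E3) :
    (Complex.I * (a - t * omega m p)).re = t.im * omega m p := by
  simp

theorem re_I_mul_sub_mul_omega_nonpos (m : ℝ) {t : ℂ} (ht : t.im ≤ 0) (a : ℝ) (p : E3) :
    (Complex.I * (a - t * omega m p)).re ≤ 0 := by
  rw [re_I_mul_sub_mul_omega]
  exact mul_nonpos_of_nonpos_of_nonneg ht (Real.sqrt_nonneg _)

/-- The function `𝐩 ↦ e^{i(𝐩·𝐳 - tω)}/ω` for a complex time `t` in the closed lower half-plane. The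
factor `1/ω` makes it Lipschitz in `(t, 𝐳)` with respect to the uniform norm. -/
def planeWave {m : ℝ} (hm : 0 < m) (t : ℂ) (ht : t.im ≤ 0) (z : E3) :
    BoundedContinuousFunction E3 ℂ :=
  BoundedContinuousFunction.ofNormedAddCommGroup
    (fun p => Complex.exp (Complex.I * ((inner ℝ p z : ℝ) - t * omega m p)) / omega m p)
    (by
      have hω := continuous_omega m
      exact Continuous.div (by fun_prop) (by fun_prop)
        fun p => Complex.ofReal_ne_zero.2 (omega_pos hm p).ne')
    m⁻¹ fun p => by
      rw [norm_div, Complex.norm_real, Real.norm_of_nonneg (omega_pos hm p).le, Complex.norm_exp,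
        inv_eq_one_div]
      exact div_le_div₀ zero_le_one
        (Real.exp_le_one_iff.2 (re_I_mul_sub_mul_omega_nonpos m ht _ p)) hm (le_omega m p)

section PlaneWave

variable {m : ℝ} (hm : 0 < m)

theorem planeWave_apply (t : ℂ) (ht : t.im ≤ 0) (z p : E3) :
    planeWave hm t ht z p =
      Complex.exp (Complex.I * ((inner ℝ p z : ℝ) - t * omega m p)) / omega m p :=
  rfl

theorem norm_planeWave_le (t : ℂ) (ht : t.im ≤ 0) (z : E3) : ‖planeWave hm t ht z‖ ≤ m⁻¹ :=
  BoundedContinuousFunction.norm_ofNormedAddCommGroup_le _ (inv_nonneg.2 hm.le) _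

theorem norm_planeWave_sub_le {t t' : ℂ} (ht : t.im ≤ 0) (ht' : t'.im ≤ 0) (z z' : E3) :
    ‖planeWave hm t ht z - planeWave hm t' ht' z'‖ ≤ ‖t - t'‖ + ‖z - z'‖ := by
  refine (BoundedContinuousFunction.norm_le (by positivity)).2 fun p => ?_
  have hω := omega_pos hm p
  have hinner : |inner ℝ p (z - z')| ≤ omega m p * ‖z - z'‖ :=
    (abs_real_inner_le_norm p (z - z')).trans (by gcongr; exact norm_le_omega m p)
  rw [BoundedContinuousFunction.sub_apply, planeWave_apply, planeWave_apply, ← sub_div, norm_div,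
    Complex.norm_real, Real.norm_of_nonneg hω.le, div_le_iff₀ hω]
  calc ‖Complex.exp (Complex.I * ((inner ℝ p z : ℝ) - t * omega m p)) -
        Complex.exp (Complex.I * ((inner ℝ p z' : ℝ) - t' * omega m p))‖
      ≤ ‖Complex.I * ((inner ℝ p z : ℝ) - t * omega m p) -
          Complex.I * ((inner ℝ p z' : ℝ) - t' * omega m p)‖ :=
        norm_cexp_sub_cexp_le (re_I_mul_sub_mul_omega_nonpos m ht _ p)
          (re_I_mul_sub_mul_omega_nonpos m ht' _ p)
    _ = ‖((inner ℝ p (z - z') : ℝ) : ℂ) - (t - t') * omega m p‖ := by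
        rw [← mul_sub, norm_mul, Complex.norm_I, one_mul, inner_sub_right]
        push_cast
        ring_nf
    _ ≤ |inner ℝ p (z - z')| + ‖t - t'‖ * omega m p := by
        refine (norm_sub_le _ _).trans_eq ?_
        rw [norm_mul, Complex.norm_real, Complex.norm_real, Real.norm_eq_abs,
          Real.norm_of_nonneg hω.le]
    _ ≤ (‖t - t'‖ + ‖z - z'‖) * omega m p := by linarith

theorem continuous_planeWave (t : ℂ) (ht : t.im ≤ 0) : Continuous (planeWave hm t ht) :=
  (LipschitzWith.of_dist_le' (K := 1) fun z z' => by
    simpa [dist_eq_norm] using norm_planeWave_sub_le hm ht ht z z').continuous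

theorem integrable_timeKernel_smul_planeWave {t : ℂ} (ht : t.im < 0) (w : E3) :
    Integrable fun z => timeKernel m t (w - z) • planeWave hm 0 le_rfl z := by
  refine (((integrable_timeKernel hm ht.ne).comp_sub_left w).norm.mul_const m⁻¹).mono' ?_
    (ae_of_all _ fun z => ?_)
  · exact (((continuous_timeKernel hm ht.ne).comp (continuous_const.sub continuous_id)).smul
      (continuous_planeWave hm 0 le_rfl)).aestronglyMeasurable
  · rw [norm_smul]
    gcongr
    exact norm_planeWave_le hm 0 le_rfl z

theorem integral_timeKernel_smul_planeWave {t : ℂ} (ht : t.im < 0) (w : E3) :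
    ∫ z, timeKernel m t (w - z) • planeWave hm 0 le_rfl z = planeWave hm t ht.le w := by
  ext p
  have hfactor (v : E3) : timeKernel m t v * planeWave hm 0 le_rfl (w - v) p =
      Complex.exp (Complex.I * (inner ℝ p w : ℝ)) / omega m p *
        (timeKernel m t v * Complex.exp (-(Complex.I * (inner ℝ p v : ℝ)))) := by
    rw [planeWave_apply, zero_mul, sub_zero, inner_sub_right, Complex.ofReal_sub, mul_sub,
      sub_eq_add_neg, Complex.exp_add]
    ring
  calc (∫ z, timeKernel m t (w - z) • planeWave hm 0 le_rfl z) p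
      = ∫ z, timeKernel m t (w - z) * planeWave hm 0 le_rfl z p :=
        ((BoundedContinuousFunction.evalCLM ℂ p).integral_comp_comm
          (integrable_timeKernel_smul_planeWave hm ht w)).symm
    _ = ∫ v, timeKernel m t v * planeWave hm 0 le_rfl (w - v) p := by
        rw [← integral_sub_left_eq_self _ volume w]
        simp only [sub_sub_cancel]
    _ = planeWave hm t ht.le w p := by
        simp only [hfactor]
        rw [integral_const_mul, integral_timeKernel_mul_cexp_neg_inner hm ht, div_mul_eq_mul_div,
          ← Complex.exp_add, planeWave_apply]
        ring_nf

end PlaneWave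

/-- The momentum weight by which `planeWave` has to be multiplied to give the coefficient function
of `phi1`. -/
def planeWaveWeight (m : ℝ) (p : E3) : ℂ :=
  (((2 * π) ^ (-(3 / 2) : ℝ) : ℝ) : ℂ) * (√(2 * omega m p) : ℝ) * (omega m p : ℂ)

theorem continuous_planeWaveWeight (m : ℝ) : Continuous (planeWaveWeight m) := by
  have hω := continuous_omega m
  unfold planeWaveWeight
  fun_prop

theorem norm_planeWaveWeight_le {m : ℝ} (hm : 0 ≤ m) (p : E3) :
    ‖planeWaveWeight m p‖ ≤ 2 * (2 * π) ^ (-(3 / 2) : ℝ) * (1 + m) ^ 2 * (1 + ‖p‖) ^ 2 := by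
  have hω : 0 ≤ omega m p := Real.sqrt_nonneg _
  have hle : omega m p ≤ (1 + m) * (1 + ‖p‖) := by
    nlinarith [omega_le hm p, mul_nonneg hm (norm_nonneg p)]
  have hone : 1 ≤ (1 + m) * (1 + ‖p‖) := by
    nlinarith [norm_nonneg p, mul_nonneg hm (norm_nonneg p)]
  have hsqrt : √(2 * omega m p) ≤ 2 * ((1 + m) * (1 + ‖p‖)) :=
    Real.sqrt_le_iff.2 ⟨by positivity, by nlinarith⟩
  calc ‖planeWaveWeight m p‖ = (2 * π) ^ (-(3 / 2) : ℝ) * √(2 * omega m p) * omega m p := by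
        rw [planeWaveWeight, ← Complex.ofReal_mul, ← Complex.ofReal_mul, Complex.norm_real,
          Real.norm_of_nonneg (by positivity)]
    _ ≤ (2 * π) ^ (-(3 / 2) : ℝ) * (2 * ((1 + m) * (1 + ‖p‖))) * ((1 + m) * (1 + ‖p‖)) := by
        gcongr
    _ = 2 * (2 * π) ^ (-(3 / 2) : ℝ) * (1 + m) ^ 2 * (1 + ‖p‖) ^ 2 := by ring

theorem planeWave_mul_planeWaveWeight {m : ℝ} (hm : 0 < m) (x : SpaceTime) (p : E3) :
    planeWave hm x.1 (Complex.ofReal_im x.1).le x.2 p * planeWaveWeight m p =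
      (starRingEnd ℂ) (localizedWave m x p) := by
  have hω : (omega m p : ℂ) ≠ 0 := Complex.ofReal_ne_zero.2 (omega_pos hm p).ne'
  have hexponent : Complex.I * ((inner ℝ p x.2 : ℝ) - (x.1 : ℂ) * omega m p) =
      -(Complex.I * (shellDot m p x : ℝ)) := by
    rw [shellDot]
    push_cast
    ring
  rw [conj_localizedWave, planeWave_apply, planeWaveWeight, hexponent]
  field_simp

theorem exists_clm_planeWave_mem_graph_phi1 {m : ℝ} (hm : 0 < m) {Ψ : Fock m}
    (hΨ : Ψ ∈ schwartzCore m) :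
    ∃ T : BoundedContinuousFunction E3 ℂ →L[ℂ] Fock m, ∀ x : SpaceTime,
      (Ψ, T (planeWave hm x.1 (Complex.ofReal_im x.1).le x.2)) ∈ (phi1 m x).graph := by
  obtain ⟨T, hT⟩ := exists_clm_mem_annihilationGraph hm (continuous_planeWaveWeight m)
    (norm_planeWaveWeight_le hm.le) hΨ
  refine ⟨T, fun x => ?_⟩
  rw [phi1, annihilation_graph, ← funext (planeWave_mul_planeWaveWeight hm x)]
  exact hT _

theorem schwartzCore_subset_domain_phi1 {m : ℝ} (hm : 0 < m) (x : SpaceTime) :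
    schwartzCore m ⊆ (phi1 m x).domain := fun _ hΨ =>
  let ⟨_, hT⟩ := exists_clm_planeWave_mem_graph_phi1 hm hΨ
  LinearPMap.mem_domain_of_mem_graph (hT x)

theorem exists_clm_planeWave_eq_phi1 {m : ℝ} (hm : 0 < m) {Ψ : Fock m} (hΨ : Ψ ∈ schwartzCore m) :
    ∃ T : BoundedContinuousFunction E3 ℂ →L[ℂ] Fock m, ∀ x : SpaceTime,
      phi1 m x ⟨Ψ, schwartzCore_subset_domain_phi1 hm x hΨ⟩ =
        T (planeWave hm x.1 (Complex.ofReal_im x.1).le x.2) := by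
  obtain ⟨T, hT⟩ := exists_clm_planeWave_mem_graph_phi1 hm hΨ
  exact ⟨T, fun x => (phi1 m x).mem_graph_snd_inj (LinearPMap.mem_graph _ _) (hT x) rfl⟩

theorem integrable_timeKernel_smul_phi1 {m : ℝ} (hm : 0 < m) {Ψ : Fock m}
    (hΨ : Ψ ∈ schwartzCore m) {t : ℂ} (ht : t.im < 0) (w : E3) :
    Integrable fun z => timeKernel m t (w - z) •
      phi1 m (0, z) ⟨Ψ, schwartzCore_subset_domain_phi1 hm (0, z) hΨ⟩ := by
  obtain ⟨T, hT⟩ := exists_clm_planeWave_eq_phi1 hm hΨ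
  simp only [hT, Complex.ofReal_zero, ← map_smul]
  exact T.integrable_comp (integrable_timeKernel_smul_planeWave hm ht w)

theorem tendsto_integral_timeKernel_smul_phi1 {m : ℝ} (hm : 0 < m) {Ψ : Fock m}
    (hΨ : Ψ ∈ schwartzCore m) (x : SpaceTime) :
    Tendsto (fun t : ℂ => ∫ z, timeKernel m t (x.2 - z) •
        phi1 m (0, z) ⟨Ψ, schwartzCore_subset_domain_phi1 hm (0, z) hΨ⟩)
      (𝓝[{t | t.im < 0}] x.1) (𝓝 (phi1 m x ⟨Ψ, schwartzCore_subset_domain_phi1 hm x hΨ⟩)) := by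
  obtain ⟨T, hT⟩ := exists_clm_planeWave_eq_phi1 hm hΨ
  have hτ : ((x.1 : ℂ)).im ≤ 0 := (Complex.ofReal_im x.1).le
  have hbound : ∀ᶠ t : ℂ in 𝓝[{t | t.im < 0}] x.1,
      ‖(∫ z, timeKernel m t (x.2 - z) •
          phi1 m (0, z) ⟨Ψ, schwartzCore_subset_domain_phi1 hm (0, z) hΨ⟩) -
        phi1 m x ⟨Ψ, schwartzCore_subset_domain_phi1 hm x hΨ⟩‖ ≤ ‖T‖ * ‖t - x.1‖ := by
    filter_upwards [self_mem_nhdsWithin] with t (ht : t.im < 0)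
    simp only [hT, Complex.ofReal_zero, ← map_smul]
    rw [T.integral_comp_comm (integrable_timeKernel_smul_planeWave hm ht x.2),
      integral_timeKernel_smul_planeWave hm ht, ← map_sub]
    refine T.le_opNorm_of_le ?_
    simpa using norm_planeWave_sub_le hm ht.le hτ x.2 x.2
  refine tendsto_iff_norm_sub_tendsto_zero.2
    (squeeze_zero' (Eventually.of_forall fun _ => norm_nonneg _) hbound ?_)
  have hcont : Continuous fun t : ℂ => ‖T‖ * ‖t - x.1‖ := by fun_prop
  simpa using (hcont.tendsto (x.1 : ℂ)).mono_left nhdsWithin_le_nhds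

theorem tendsto_sub_ofReal_mul_I (τ : ℝ) :
    Tendsto (fun ε : ℝ => (τ : ℂ) - ε * Complex.I) (𝓝[>] 0) (𝓝[{t | t.im < 0}] τ) := by
  refine tendsto_nhdsWithin_iff.2 ⟨?_, ?_⟩
  · have hcont : Continuous fun ε : ℝ => (τ : ℂ) - ε * Complex.I := by fun_prop
    simpa using (hcont.tendsto 0).mono_left nhdsWithin_le_nhds
  · filter_upwards [self_mem_nhdsWithin] with ε (hε : 0 < ε)
    simpa using hε

theorem conjugate_aTilde_eq_phi1 {m : ℝ} (hm : 0 < m) (y : SpaceTime) (e : E3 ≃ₗᵢ[ℝ] E3) (x : E3) :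
    conjugate (fockUnitary m y e) (aTilde m x) = phi1 m (y.1, e x + y.2) := by
  rw [aTilde_eq_phi1 hm, conjugate_phi1, zero_add]

end ScalarField

end

open ScalarField in
theorem mainTheorem3_general (m : ℝ) (hm : 0 < m) (y : SpaceTime) (e : E3 ≃ₗᵢ[ℝ] E3) :
    (∀ x : SpaceTime, schwartzCore m ⊆ (phi1 m x).domain ∧
      conjugate (fockUnitary m y e) (phi1 m x) = phi1 m (x.1 + y.1, e x.2 + y.2)) ∧
    (∀ x : E3, ∀ Ψ ∈ schwartzCore m,
      ∃ (hU : Ψ ∈ (conjugate (fockUnitary m y e) (aTilde m x)).domain)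
        (hz : ∀ z : E3, Ψ ∈ (aTilde m z).domain),
        (∀ t : ℂ, t.im < 0 → Integrable fun z : E3 =>
          timeKernel m t (e x + y.2 - z) • aTilde m z ⟨Ψ, hz z⟩) ∧
        Tendsto (fun t : ℂ => ∫ z : E3, timeKernel m t (e x + y.2 - z) • aTilde m z ⟨Ψ, hz z⟩)
          (𝓝[{t | t.im < 0}] y.1)
          (𝓝 (conjugate (fockUnitary m y e) (aTilde m x) ⟨Ψ, hU⟩))) ∧
    TendstoLocallyUniformlyOn (timeKernel m) (timeKernel m y.1) (𝓝 (y.1 : ℂ))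
      {v | |y.1| < ‖v‖} := by
  refine ⟨fun x => ⟨schwartzCore_subset_domain_phi1 hm x, conjugate_phi1 m y e x⟩,
    fun x Ψ hΨ => ?_, tendstoLocallyUniformlyOn_timeKernel hm y.1⟩
  rw [conjugate_aTilde_eq_phi1 hm, funext (aTilde_eq_phi1 hm)]
  exact ⟨schwartzCore_subset_domain_phi1 hm _ hΨ,
    fun z => schwartzCore_subset_domain_phi1 hm (0, z) hΨ,
    fun t ht => integrable_timeKernel_smul_phi1 hm hΨ ht _,
    tendsto_integral_timeKernel_smul_phi1 hm hΨ (y.1, e x + y.2)⟩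

theorem mainTheorem3 (m : ℝ) (hm : 0 < m) (y : ScalarField.SpaceTime)
    (R : Matrix.specialOrthogonalGroup (Fin 3) ℝ) :
    -- covariance of `φ₁`, an equality of densely defined operators with their domains
    (∀ x : ScalarField.SpaceTime,
      ScalarField.schwartzCore m ⊆ (ScalarField.phi1 m x).domain ∧
      ScalarField.conjugate (ScalarField.U m y R) (ScalarField.phi1 m x) =
        ScalarField.phi1 m (x.1 + y.1, ScalarField.rot R x.2 + y.2)) ∧
    -- the convolution formula for `ã`, with `y⁰` approached from the lower half-plane
    (∀ (x : ScalarField.E3), ∀ Ψ ∈ ScalarField.schwartzCore m,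
      ∃ (hU : Ψ ∈ (ScalarField.conjugate (ScalarField.U m y R) (ScalarField.aTilde m x)).domain)
        (hz : ∀ z : ScalarField.E3, Ψ ∈ (ScalarField.aTilde m z).domain),
        (∀ ε : ℝ, 0 < ε → Integrable (fun z : ScalarField.E3 =>
          ScalarField.timeKernel m (y.1 - ε * Complex.I) (ScalarField.rot R x + y.2 - z) •
            ScalarField.aTilde m z ⟨Ψ, hz z⟩)) ∧
        Tendsto (fun ε : ℝ => ∫ z : ScalarField.E3,
          ScalarField.timeKernel m (y.1 - ε * Complex.I) (ScalarField.rot R x + y.2 - z) •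
            ScalarField.aTilde m z ⟨Ψ, hz z⟩) (𝓝[>] 0)
          (𝓝 (ScalarField.conjugate (ScalarField.U m y R) (ScalarField.aTilde m x) ⟨Ψ, hU⟩))) ∧
    -- in the space-like region the limiting kernel is the displayed function at real time `y⁰`
    TendstoLocallyUniformlyOn
      (fun (ε : ℝ) (v : ScalarField.E3) => ScalarField.timeKernel m (y.1 - ε * Complex.I) v)
      (fun v => ScalarField.timeKernel m y.1 v) (𝓝[>] 0) {v | |y.1| < ‖v‖} := by
  obtain ⟨hφ, ha, hK⟩ := mainTheorem3_general m hm y (ScalarField.rot R)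
  have hε := ScalarField.tendsto_sub_ofReal_mul_I y.1
  refine ⟨hφ, fun x Ψ hΨ => ?_, fun u hu v hv => ?_⟩
  · obtain ⟨hU, hz, hint, hlim⟩ := ha x Ψ hΨ
    exact ⟨hU, hz, fun ε hε => hint _ (by simpa using hε), hlim.comp hε⟩
  · obtain ⟨s, hs, hKs⟩ := hK u hu v hv
    exact ⟨s, hs, hε.eventually (hKs.filter_mono nhdsWithin_le_nhds)⟩
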